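/- Let $d\ge 2$ and let $\theta=(\theta_{kj})$ be a real skew-symmetric $d\times d$ matrix. Let $\mathbb T^d_\theta$ be the $d$-dimensional quantum torus: the von Neumann algebra generated by the unitaries $U_1,\dots,U_d$ with $U_kU_j=e^{2\pi i\theta_{kj}}U_jU_k$, in the GNS representation on $L_2(\mathbb T^d_\theta)$ of the trace $\tau\big(\sum_m\alpha_mU^m\big)=\alpha_0$. Here $U^m=U_1^{m_1}\cdots U_d^{m_d}$ for $m\in\mathbb Z^d$, and $\hat x(m)=\tau((U^m)^*x)$ for $x\in\mathbb T^d_\theta$. Let $\mathbb T^d$ be the usual torus with normalized Haar measure and $\hat f(m)=\int_{\mathbb T^d}z^{-m}f(z)\,dz$. The spaces $\mathbb T^d_\theta\subset B(L_2(\mathbb T^d_\theta))$ and $L_\infty(\mathbb T^d)\subset B(L_2(\mathbb T^d))$ (acting by multiplication) carry the resulting operator space structures. A function $\phi:\mathbb Z^d\to\mathbb C$ is a bounded (resp. completely bounded) Fourier multiplier on $\mathbb T^d_\theta$ if there is a bounded (resp. completely bounded) linear map $T_\phi:\mathbb T^d_\theta\to\mathbb T^d_\theta$ with $\widehat{T_\phi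 x}(m)=\phi(m)\hat x(m)$ for all $x\in\mathbb T^d_\theta$ and $m\in\mathbb Z^d$; such a map is unique, and the norm of $\phi$ is the operator norm $\|T_\phi\|$ (resp. $\|T_\phi\|_{\rm cb}=\sup_n\|\mathrm{id}_{\mathbb M_n}\otimes T_\phi\|$). Multipliers on $L_\infty(\mathbb T^d)$ are defined in the same way. Let $\mathrm M_{\rm cb}(\mathbb T^d_\theta)$, $\mathrm M_{\rm cb}(L_\infty(\mathbb T^d))$ and $\mathrm M(L_\infty(\mathbb T^d))$ be the corresponding spaces of multipliers with these norms. Then $$\mathrm M_{\rm cb}(\mathbb T^d_\theta)=\mathrm M_{\rm cb}(L_\infty(\mathbb T^d))=\mathrm M(L_\infty(\mathbb T^d))\quad\text{with equal norms}.$$ Moreover, $\mathrm M(L_\infty(\mathbb T^d))$ is exactly the set of Fourier transforms $\hat\mu(m)=\int_{\mathbb T^d}z^{-m}\,d\mu(z)$, $m\in\mathbb Z^d$, of bounded (complex) Borel measures $\mu$ on $\mathbb T^d$, and the norm of $\hat\mu$ in $\mathrm M(L_\infty(\mathbb T^d))$ is the total variation $\|\mu\|=|\mu|(\mathbb T^d)$.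 -/

import Mathlib

open MeasureTheory
open scoped ENNReal Matrix

noncomputable section

/-! ### Completely bounded maps between concrete operator spaces -/

section CompletelyBounded

variable {H : Type*} [NormedAddCommGroup H] [InnerProductSpace ℂ H]
variable {K : Type*} [NormedAddCommGroup K] [InnerProductSpace ℂ K]
variable {E : Type*} [AddCommGroup E] [Module ℂ E]
variable {F : Type*} [AddCommGroup F] [Module ℂ F]

/-- The operator on `ℓ₂ⁿ(H)` given by an `n × n` matrix of operators on `H`:
`(a ξ)ᵢ = ∑ⱼ aᵢⱼ ξⱼ`. -/
def matrixOperator {n : ℕ} (a : Matrix (Fin n) (Fin n) (H →L[ℂ] H)) :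
    PiLp 2 (fun _ : Fin n => H) →L[ℂ] PiLp 2 (fun _ : Fin n => H) :=
  ((PiLp.continuousLinearEquiv 2 ℂ (fun _ : Fin n => H)).symm :
      (Fin n → H) →L[ℂ] PiLp 2 (fun _ : Fin n => H)) ∘L
    ContinuousLinearMap.pi fun i => ∑ j, a i j ∘L PiLp.proj 2 (fun _ : Fin n => H) j

/-- The norm of `𝕄ₙ(E)`, where the operator space structure of `E` is given by an
embedding `ρ : E → B(H)`. -/
def matrixNorm (ρ : E →ₗ[ℂ] H →L[ℂ] H) {n : ℕ} (a : Matrix (Fin n) (Fin n) E) : ℝ≥0∞ :=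
  ‖matrixOperator (a.map ρ)‖ₑ

/-- The completely bounded norm `supₙ ‖id_{𝕄ₙ} ⊗ u : 𝕄ₙ(E) → 𝕄ₙ(F)‖ ∈ [0, ∞]` of a linear map
`u : E → F` between operator spaces `ρ : E → B(H)` and `σ : F → B(K)`; the map `u` is completely
bounded when this is finite. -/
def cbNorm (ρ : E →ₗ[ℂ] H →L[ℂ] H) (σ : F →ₗ[ℂ] K →L[ℂ] K) (u : E →ₗ[ℂ] F) : ℝ≥0∞ :=
  ⨆ (n : ℕ) (a : Matrix (Fin n) (Fin n) E) (_ : matrixNorm ρ a ≤ 1), matrixNorm σ (a.map u)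

end CompletelyBounded

/-! ### The quantum torus -/

namespace QuantumTorus

variable {d : ℕ}

/-- The GNS space `L₂(𝕋^d_θ)` of the canonical trace, in the coordinates given by its orthonormal
basis `(U^m)`, `m ∈ ℤ^d`. -/
abbrev L2 (d : ℕ) : Type := lp (fun _ : Fin d → ℤ => ℂ) 2

/-- The phase with `U_j U^n = phase θ j n • U^{n + e_j}`, where `U^n = U_1^{n_1} ⋯ U_d^{n_d}`,
obtained by moving `U_j` to the right past `U_k^{n_k}` for all `k < j`. -/
def phase (θ : Matrix (Fin d) (Fin d) ℝ) (j : Fin d) (n : Fin d → ℤ) : Circle :=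
  Circle.exp (2 * Real.pi * ∑ k ∈ Finset.univ.filter (· < j), θ j k * n k)

/-- A weighted translation is square summable together with the sequence it acts on. -/
theorem memℓp_weighted (c : (Fin d → ℤ) → Circle) (e : Equiv.Perm (Fin d → ℤ)) (x : L2 d) :
    Memℓp (fun n => (c n : ℂ) * x (e n)) 2 := by
  have h2 : (0 : ℝ) < (2 : ℝ≥0∞).toReal := by norm_num
  have hx := (memℓp_gen_iff h2).1 (lp.memℓp x)
  refine (memℓp_gen_iff h2).2 ?_
  simpa [norm_mul, Circle.norm_coe, Function.comp_def] using
    (e.summable_iff (f := fun n => ‖x n‖ ^ (2 : ℝ≥0∞).toReal)).2 hx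

/-- The unitary `(V x)(n) = c(n) x(e(n))` of `ℓ₂(ℤ^d)`. -/
def weighted (c : (Fin d → ℤ) → Circle) (e : Equiv.Perm (Fin d → ℤ)) : L2 d ≃ₗᵢ[ℂ] L2 d where
  toFun x := ⟨fun n => (c n : ℂ) * x (e n), memℓp_weighted c e x⟩
  invFun x := ⟨fun n => ((c (e.symm n))⁻¹ : Circle) * x (e.symm n),
    memℓp_weighted (fun n => (c (e.symm n))⁻¹) e.symm x⟩
  map_add' x y := by ext n; exact mul_add _ _ _
  map_smul' a x := by ext n; simp [mul_left_comm]
  left_inv x := by ext n; simp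
  right_inv x := by ext n; simp
  norm_map' x := by
    have h2 : (0 : ℝ) < (2 : ℝ≥0∞).toReal := by norm_num
    simp only [lp.norm_eq_tsum_rpow h2]
    congr 1
    simpa [norm_mul, Circle.norm_coe] using! e.tsum_eq (fun n => ‖x n‖ ^ (2 : ℝ≥0∞).toReal)

/-- The canonical unitary generator `U_j`, acting on `L₂(𝕋^d_θ)` by left multiplication. -/
def gen (θ : Matrix (Fin d) (Fin d) ℝ) (j : Fin d) : L2 d ≃ₗᵢ[ℂ] L2 d :=
  weighted (fun n => phase θ j (n - Pi.single j 1)) (Equiv.subRight (Pi.single j 1))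

theorem gen_apply (θ : Matrix (Fin d) (Fin d) ℝ) (j : Fin d) (x : L2 d) (n : Fin d → ℤ) :
    gen θ j x n = phase θ j (n - Pi.single j 1) * x (n - Pi.single j 1) := rfl

/-- The monomial `U^m = U_1^{m_1} ⋯ U_d^{m_d}`. -/
def monomial (θ : Matrix (Fin d) (Fin d) ℝ) (m : Fin d → ℤ) : L2 d ≃ₗᵢ[ℂ] L2 d :=
  (List.ofFn fun k => gen θ k ^ m k).prod

/-- A linear isometric automorphism as a bounded operator. -/
def toOp (V : L2 d ≃ₗᵢ[ℂ] L2 d) : L2 d →L[ℂ] L2 d := (V.toContinuousLinearEquiv : L2 d →L[ℂ] L2 d)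

/-- The quantum torus `𝕋^d_θ`: the von Neumann algebra on `L₂(𝕋^d_θ)` generated by
`U_1, …, U_d`, that is, the double commutant of these unitaries and their adjoints. -/
def algebra (θ : Matrix (Fin d) (Fin d) ℝ) : VonNeumannAlgebra (L2 d) where
  toStarSubalgebra := StarSubalgebra.centralizer ℂ
    (StarSubalgebra.centralizer ℂ (Set.range fun j => toOp (gen θ j)) : Set (L2 d →L[ℂ] L2 d))
  centralizer_centralizer' := by
    change Set.centralizer (Set.centralizer (StarSubalgebra.centralizer ℂ
      (StarSubalgebra.centralizer ℂ (Set.range fun j => toOp (gen θ j)) :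
        Set (L2 d →L[ℂ] L2 d)) : Set (L2 d →L[ℂ] L2 d))) =
      (StarSubalgebra.centralizer ℂ
      (StarSubalgebra.centralizer ℂ (Set.range fun j => toOp (gen θ j)) :
        Set (L2 d →L[ℂ] L2 d)) : Set (L2 d →L[ℂ] L2 d))
    simp only [StarSubalgebra.coe_centralizer_centralizer, Set.centralizer_centralizer_centralizer]

/-- The inclusion of `𝕋^d_θ` in `B(L₂(𝕋^d_θ))`. -/
def incl (θ : Matrix (Fin d) (Fin d) ℝ) : (algebra θ).toSubalgebra →ₗ[ℂ] L2 d →L[ℂ] L2 d :=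
  (algebra θ).toSubalgebra.toSubmodule.subtype

/-- The unit vector `U^0` of `L₂(𝕋^d_θ)`. -/
def vac (d : ℕ) : L2 d := lp.single 2 0 1

/-- The canonical trace `τ(x) = ⟨x U^0, U^0⟩`. -/
def trace (x : L2 d →L[ℂ] L2 d) : ℂ := inner ℂ (vac d) (x (vac d))

/-- The Fourier coefficient `x̂(m) = τ((U^m)^* x)`. -/
def coeff (θ : Matrix (Fin d) (Fin d) ℝ) (x : L2 d →L[ℂ] L2 d) (m : Fin d → ℤ) : ℂ :=
  trace (star (toOp (monomial θ m)) * x)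

/-- The generators satisfy `U_k U_j = e^{2πi θ_{kj}} U_j U_k`. -/
theorem gen_comm (θ : Matrix (Fin d) (Fin d) ℝ) (hθ : θᵀ = -θ) (k j : Fin d) :
    toOp (gen θ k) * toOp (gen θ j) =
      Complex.exp (2 * Real.pi * Complex.I * θ k j) • (toOp (gen θ j) * toOp (gen θ k)) := by
  have hs : ∀ a b, θ a b = - θ b a := fun a b => by
    simpa using congrFun (congrFun hθ b) a
  have hd : ∀ a, θ a a = 0 := fun a => by have := hs a a; linarith
  ext x n
  change gen θ k (gen θ j x) n = Complex.exp _ * gen θ j (gen θ k x) n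
  simp only [gen_apply]
  have key : ∀ a b : Fin d, ∀ v : Fin d → ℤ,
      (phase θ a (v - Pi.single b 1) : ℂ) =
        (phase θ a v : ℂ) * Complex.exp (if b < a then -(2 * Real.pi * Complex.I * θ a b) else 0) := by
    intro a b v
    simp only [phase, Circle.coe_exp, ← Complex.exp_add]
    congr 1
    have : ∑ i ∈ Finset.univ.filter (· < a), θ a i * (((v - Pi.single b 1 : Fin d → ℤ) i : ℤ) : ℝ) =
        ∑ i ∈ Finset.univ.filter (· < a), θ a i * v i - if b < a then θ a b else 0 := by
      simp [mul_sub, Finset.sum_sub_distrib, Pi.single_apply, Finset.sum_ite_eq', Finset.sum_filter]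
    rw [this]
    split_ifs <;> push_cast <;> ring
  have e1 : n - Pi.single j 1 - Pi.single k 1 = (n - Pi.single k 1) - Pi.single j 1 :=
    sub_right_comm _ _ _
  have e2 : Complex.exp (if k < j then -(2 * Real.pi * Complex.I * θ j k) else 0) =
      Complex.exp (2 * Real.pi * Complex.I * θ k j) *
        Complex.exp (if j < k then -(2 * Real.pi * Complex.I * θ k j) else 0) := by
    rw [← Complex.exp_add]
    congr 1
    rcases lt_trichotomy k j with h | rfl | h
    · rw [if_pos h, if_neg h.not_gt, hs j k]; push_cast; ring
    · simp [hd]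
    · rw [if_neg h.not_gt, if_pos h]; ring
  have k1 := key j k (n - Pi.single j 1)
  have k2 := key k j (n - Pi.single k 1)
  rw [e2, e1] at k1
  rw [e1, k1, k2]
  ring

theorem gen_zpow_single (θ : Matrix (Fin d) (Fin d) ℝ) (j : Fin d) (z : ℤ) (m : Fin d → ℤ)
    (hm : ∀ k < j, m k = 0) :
    (gen θ j ^ z) (lp.single 2 m 1) = lp.single 2 (m + Pi.single j z) 1 := by
  have step : ∀ m : Fin d → ℤ, (∀ k < j, m k = 0) →
      gen θ j (lp.single 2 m 1) = lp.single 2 (m + Pi.single j 1) 1 := by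
    intro m hm
    ext n
    rw [gen_apply]
    by_cases h : n = m + Pi.single j 1
    · subst h
      have : phase θ j m = 1 := by
        have h0 : ∑ k ∈ Finset.univ.filter (· < j), θ j k * (m k : ℝ) = 0 :=
          Finset.sum_eq_zero fun k hk => by simp [hm k (by simpa using hk)]
        simp [phase, h0]
      simp [this]
    · have h' : n - Pi.single j 1 ≠ m := fun h0 => h (by rw [← h0]; abel)
      simp [lp.single_apply, h, h']
  induction z using Int.induction_on with
  | zero => simp
  | succ i ih =>
    rw [add_comm, zpow_add, zpow_one]
    change gen θ j ((gen θ j ^ (i : ℤ)) _) = _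
    rw [ih, step _ fun k hk => by simp [hm k hk, hk.ne], add_assoc, ← Pi.single_add, add_comm (i : ℤ)]
  | pred i ih =>
    apply (gen θ j).injective
    have : gen θ j ^ (-(i : ℤ)) = gen θ j * gen θ j ^ (-(i : ℤ) - 1) := by
      rw [← zpow_one_add]; congr 1; ring
    rw [step _ fun k hk => by simp [hm k hk, hk.ne], add_assoc, ← Pi.single_add, sub_add_cancel, ← ih,
      this]
    rfl

/-- `U^m` applied to `U^0` is the basis vector with index `m`. -/
theorem monomial_vac (θ : Matrix (Fin d) (Fin d) ℝ) (m : Fin d → ℤ) :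
    monomial θ m (vac d) = lp.single 2 m 1 := by
  have key : ∀ l : List (Fin d), l.Pairwise (· < ·) →
      (l.map fun k => gen θ k ^ m k).prod (vac d) =
        lp.single 2 ((l.map fun k => Pi.single k (m k)).sum : Fin d → ℤ) 1 := by
    intro l
    induction l with
    | nil => intro _; rfl
    | cons a l ih =>
      intro h
      rw [List.pairwise_cons] at h
      rw [List.map_cons, List.prod_cons, List.map_cons, List.sum_cons, add_comm]
      change (gen θ a ^ m a) ((l.map fun k => gen θ k ^ m k).prod (vac d)) = _
      rw [ih h.2, gen_zpow_single]
      intro k hk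
      have : ∀ l : List (Fin d), (∀ b ∈ l, a < b) →
          ((l.map fun k => Pi.single k (m k)).sum : Fin d → ℤ) k = 0 := by
        intro l
        induction l with
        | nil => simp
        | cons b l ih2 =>
          intro hb
          have hkb : k ≠ b := (hk.trans (hb b (by simp))).ne
          have := ih2 fun c hc => hb c (by simp [hc])
          simp [hkb, this]
      exact this l h.1
  have h := key (List.finRange d) (List.pairwise_lt_finRange d)
  rw [monomial, List.ofFn_eq_map, h, ← List.ofFn_eq_map, List.sum_ofFn, Finset.univ_sum_single]

/-- The trace is the constant coefficient: `τ(∑ αₘ U^m) = α₀`. -/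
theorem trace_monomial (θ : Matrix (Fin d) (Fin d) ℝ) (m : Fin d → ℤ) :
    trace (toOp (monomial θ m)) = if m = 0 then 1 else 0 := by
  change inner ℂ (vac d) (monomial θ m (vac d)) = _
  rw [monomial_vac, vac, lp.inner_single_left]
  by_cases h : m = 0
  · simp [h]
  · simp [lp.single_apply, h, Ne.symm h]

/-- `T` is the Fourier multiplier with symbol `φ` on `𝕋^d_θ`: the Fourier coefficients of
`T x` are `φ_m x̂(m)`, for every `x ∈ 𝕋^d_θ`. At most one `T` has this property. -/
def IsMultiplierMap (θ : Matrix (Fin d) (Fin d) ℝ) (φ : (Fin d → ℤ) → ℂ)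
    (T : (algebra θ).toSubalgebra →ₗ[ℂ] (algebra θ).toSubalgebra) : Prop :=
  ∀ x m, coeff θ (incl θ (T x)) m = φ m * coeff θ (incl θ x) m

/-- The c.b. norm of `T_φ` on `𝕋^d_θ`, equal to `∞` if `T_φ` is not defined on all of `𝕋^d_θ` or
not completely bounded. (The infimum is over a set with at most one element.) -/
def cbMultiplierNorm (θ : Matrix (Fin d) (Fin d) ℝ) (φ : (Fin d → ℤ) → ℂ) : ℝ≥0∞ :=
  ⨅ (T : (algebra θ).toSubalgebra →ₗ[ℂ] (algebra θ).toSubalgebra) (_ : IsMultiplierMap θ φ T),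
    cbNorm (incl θ) (incl θ) T

/-- `M_cb(𝕋^d_θ)`: the symbols of completely bounded Fourier multipliers on `𝕋^d_θ`. -/
def cbMultipliers (θ : Matrix (Fin d) (Fin d) ℝ) : Set ((Fin d → ℤ) → ℂ) :=
  {φ | ∃ T, IsMultiplierMap θ φ T ∧ cbNorm (incl θ) (incl θ) T < ∞}

end QuantumTorus

/-! ### The classical torus -/

namespace ClassicalTorus

/-- The normalized Haar measure on the torus `(ℝ/ℤ)^d`. -/
abbrev haar (d : ℕ) : Measure (UnitAddTorus (Fin d)) :=
  Measure.pi fun _ => AddCircle.haarAddCircle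

/-- `L_∞(𝕋^d)`. -/
abbrev Linf (d : ℕ) : Type := Lp ℂ ∞ (haar d)

/-- `L_2(𝕋^d)`. -/
abbrev L2 (d : ℕ) : Type := Lp ℂ 2 (haar d)

/-- The Fourier coefficient `f̂(m) = ∫ z^{-m} f(z) dz` of a function on `𝕋^d`. -/
def coeff {d : ℕ} (f : UnitAddTorus (Fin d) → ℂ) (m : Fin d → ℤ) : ℂ :=
  ∫ t, UnitAddTorus.mFourier (-m) t * f t ∂(haar d)

/-- The representation of `L_∞(𝕋^d)` on `L_2(𝕋^d)` by multiplication operators, which gives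
`L_∞(𝕋^d)` its operator space structure. -/
def mulRep (d : ℕ) : Linf d →ₗ[ℂ] L2 d →L[ℂ] L2 d :=
  ((ContinuousLinearMap.mul ℂ ℂ).holderL (haar d) ∞ 2 2 : Linf d →L[ℂ] L2 d →L[ℂ] L2 d)

/-- `T` is the Fourier multiplier with symbol `φ` on `L_∞(𝕋^d)`. At most one `T` has this
property. -/
def IsMultiplierMap {d : ℕ} (φ : (Fin d → ℤ) → ℂ) (T : Linf d →ₗ[ℂ] Linf d) : Prop :=
  ∀ f m, coeff (T f) m = φ m * coeff f m

/-- The c.b. norm of `T_φ` on `L_∞(𝕋^d)`, equal to `∞` if `T_φ` is not defined on all of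
`L_∞(𝕋^d)` or not completely bounded. -/
def cbMultiplierNorm {d : ℕ} (φ : (Fin d → ℤ) → ℂ) : ℝ≥0∞ :=
  ⨅ (T : Linf d →ₗ[ℂ] Linf d) (_ : IsMultiplierMap φ T), cbNorm (mulRep d) (mulRep d) T

/-- `M_cb(L_∞(𝕋^d))`: the symbols of completely bounded Fourier multipliers on `L_∞(𝕋^d)`. -/
def cbMultipliers (d : ℕ) : Set ((Fin d → ℤ) → ℂ) :=
  {φ | ∃ T : Linf d →ₗ[ℂ] Linf d, IsMultiplierMap φ T ∧ cbNorm (mulRep d) (mulRep d) T < ∞}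

/-- The operator norm of `T_φ` on `L_∞(𝕋^d)`, equal to `∞` if `T_φ` is not a bounded operator on
`L_∞(𝕋^d)`. -/
def multiplierNorm {d : ℕ} (φ : (Fin d → ℤ) → ℂ) : ℝ≥0∞ :=
  ⨅ (T : Linf d →L[ℂ] Linf d) (_ : IsMultiplierMap φ (T : Linf d →ₗ[ℂ] Linf d)), ‖T‖ₑ

/-- `M(L_∞(𝕋^d))`: the symbols of bounded Fourier multipliers on `L_∞(𝕋^d)`. -/
def multipliers (d : ℕ) : Set ((Fin d → ℤ) → ℂ) :=
  {φ | ∃ T : Linf d →L[ℂ] Linf d, IsMultiplierMap φ (T : Linf d →ₗ[ℂ] Linf d)}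

/-- The Fourier transform `μ̂(m) = ∫ z^{-m} dμ(z)` of a bounded (complex) Borel measure. -/
def fourierTransform {d : ℕ} (μ : ComplexMeasure (UnitAddTorus (Fin d))) (m : Fin d → ℤ) : ℂ :=
  μ.integral (fun t => UnitAddTorus.mFourier (-m) t) (ContinuousLinearMap.mul ℝ ℂ)

end ClassicalTorus

end

/-! All three norms are compared with one quantity: the norm of the functional `z^{-m} ↦ φ(m)` on
trigonometric polynomials with the supremum norm (`SymbolBound`). If it is at most `C`, density of
the polynomials and the Riesz representation theorem give `φ = μ̂` with `|μ|(𝕋^d) ≤ C`.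

From measures to multipliers: write `μ = hν` and let `D_z e_n = z^n e_n` on `ℓ₂(ℤ^d)`. The average
`x ↦ ∫ D_z^* x D_z h(z) dν(z)` multiplies the matrix entry `(j, k)` by `μ̂(j - k)`, so its symbol is
`μ̂`. As an integral of unitary conjugations of total weight `∫ |h| dν = ‖μ‖`, it has cb norm at
most `‖μ‖` (`cbNorm_le_of_inner_eq_integral`). It preserves `𝕋^d_θ` because `D_z U_j D_z^* = z_j
U_j`. In Fourier coordinates the same formula describes convolution with `μ` on `L_∞(𝕋^d)`.

From multipliers to symbols: on `L_∞(𝕋^d)`, apply `T` to `∑ c_m z^m` and evaluate at the origin. On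
the quantum torus there is no point to evaluate at, and complete boundedness takes over. For
distinct `s_1, …, s_n` the matrix `(c(s_i - s_j) U^{s_i} (U^{s_j})^*)` is a scalar Toeplitz matrix
conjugated by a diagonal unitary, so its norm is at most `‖∑ c_m z^{-m}‖_∞`, whatever `θ` is. As
`U^s (U^t)^*` is a multiple of `U^{s-t}`, `T` multiplies the entries by `φ(s_i - s_j)`. Pairing with
the vector `(U^{s_j} v)_j` bounds `∑_{i,j} (cφ)(s_i - s_j)` by `n ‖T‖_cb ‖∑ c_m z^{-m}‖_∞`
(`norm_sum_symbol_le`). Over large boxes, which form a Følner sequence, division by `n` leaves `∑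
c_m φ(m)` (`SymbolBound.of_norm_sum_le`). -/

open MeasureTheory
open scoped ENNReal Matrix

noncomputable section

/-! ### Complex measures as densities -/

section ComplexMeasures

open Filter Topology

variable {X : Type*} [MeasurableSpace X]

/-- A complex measure has an integrable density with respect to some finite measure. -/
theorem MeasureTheory.ComplexMeasure.exists_eq_withDensityᵥ (μ : ComplexMeasure X) :
    ∃ (ν : Measure X) (h : X → ℂ), IsFiniteMeasure ν ∧ Integrable h ν ∧ μ = ν.withDensityᵥ h := by
  set s := ComplexMeasure.re μ
  set t := ComplexMeasure.im μ
  -- This measure dominates the real and the imaginary part, so Radon–Nikodym applies to both.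
  set ν : Measure X := s.totalVariation + t.totalVariation
  have hac : ∀ u : SignedMeasure X, u.totalVariation ≤ ν → u ≪ᵥ ν.toENNRealVectorMeasure := by
    intro u hu
    refine VectorMeasure.AbsolutelyContinuous.mk fun E hE h0 => ?_
    rw [Measure.toENNRealVectorMeasure_apply_measurable hE] at h0
    have h1 := (SignedMeasure.enorm_le_totalVariation u E).trans (hu E)
    simpa [h0] using h1
  have hs : s ≪ᵥ ν.toENNRealVectorMeasure := hac s (Measure.le_add_right le_rfl)
  have ht : t ≪ᵥ ν.toENNRealVectorMeasure := hac t (Measure.le_add_left le_rfl)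
  have hsi := SignedMeasure.integrable_rnDeriv s ν
  have hti := SignedMeasure.integrable_rnDeriv t ν
  have hi : Integrable (fun x => (s.rnDeriv ν x : ℂ) + (t.rnDeriv ν x : ℂ) * Complex.I) ν :=
    hsi.ofReal.add (hti.ofReal.mul_const _)
  refine ⟨ν, _, inferInstance, hi, ?_⟩
  ext E hE
  have e1 := congrArg (fun m : SignedMeasure X => m E) (SignedMeasure.withDensityᵥ_rnDeriv_eq s ν hs)
  have e2 := congrArg (fun m : SignedMeasure X => m E) (SignedMeasure.withDensityᵥ_rnDeriv_eq t ν ht)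
  simp only [withDensityᵥ_apply hsi hE, withDensityᵥ_apply hti hE] at e1 e2
  have e3 : ∫ x in E, ((s.rnDeriv ν x : ℂ) + (t.rnDeriv ν x : ℂ) * Complex.I) ∂ν =
      ∫ x in E, (s.rnDeriv ν x : ℂ) ∂ν + ∫ x in E, (t.rnDeriv ν x : ℂ) * Complex.I ∂ν :=
    integral_add hsi.ofReal.integrableOn (hti.ofReal.mul_const _).integrableOn
  rw [withDensityᵥ_apply hi hE, e3, integral_mul_const, integral_complex_ofReal,
    integral_complex_ofReal, e1, e2]
  exact (Complex.re_add_im (μ E)).symm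

theorem isFiniteMeasure_variation_withDensityᵥ {ν : Measure X} {h : X → ℂ} (hh : Integrable h ν) :
    IsFiniteMeasure (ν.withDensityᵥ h).variation := by
  rw [Measure.variation_withDensityᵥ hh]
  exact isFiniteMeasure_withDensity hh.2.ne

/-- Integration of a bounded function against a complex measure given by a density. -/
theorem integral_withDensityᵥ {ν : Measure X} {h : X → ℂ} (hh : Integrable h ν)
    {f : X → ℂ} (hf : StronglyMeasurable f) {C : ℝ} (hC : ∀ x, ‖f x‖ ≤ C) :
    (ν.withDensityᵥ h).integral f (ContinuousLinearMap.mul ℝ ℂ) = ∫ x, f x * h x ∂ν := by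
  have hfin := isFiniteMeasure_variation_withDensityᵥ hh
  have hsimple : ∀ g : SimpleFunc X ℂ,
      (ν.withDensityᵥ h).integral g (ContinuousLinearMap.mul ℝ ℂ) = ∫ x, g x * h x ∂ν := by
    intro g
    induction g using SimpleFunc.induction with
    | const c hs =>
      rename_i s
      have : ∀ x, s.indicator (fun _ => c) x * h x = s.indicator (fun x => c * h x) x := by
        intro x; by_cases hx : x ∈ s <;> simp [hx]
      have hg : ⇑(SimpleFunc.piecewise s hs (SimpleFunc.const X c) (SimpleFunc.const X 0)) =
          s.indicator fun _ => c := by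
        ext x; by_cases hx : x ∈ s <;> simp [hx]
      rw [hg, VectorMeasure.integral_indicator hs, VectorMeasure.integral_const]
      simp only [this]
      rw [integral_indicator hs, integral_const_mul]
      simp [VectorMeasure.restrict_apply, hs, withDensityᵥ_apply hh hs]
    | add hd h1 h2 =>
      rename_i f g
      have bi : ∀ f : SimpleFunc X ℂ, Integrable (fun x => f x * h x) ν := fun f => by
        obtain ⟨C, hC⟩ := f.exists_forall_norm_le
        exact hh.bdd_mul f.stronglyMeasurable.aestronglyMeasurable (ae_of_all _ hC)
      have bv : ∀ f : SimpleFunc X ℂ, (ν.withDensityᵥ h).Integrable f := fun f => by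
        obtain ⟨C, hC⟩ := f.exists_forall_norm_le
        exact Integrable.of_bound f.stronglyMeasurable.aestronglyMeasurable C (ae_of_all _ hC)
      simp only [SimpleFunc.coe_add]
      rw [VectorMeasure.integral_add (bv _) (bv _), h1, h2, ← integral_add (bi _) (bi _)]
      simp [add_mul]
  have hC0 : ∀ x : X, 0 ≤ C := fun x => (norm_nonneg _).trans (hC x)
  rcases isEmpty_or_nonempty X with hX | ⟨⟨x0⟩⟩
  · simp [VectorMeasure.integral_of_isEmpty, Measure.eq_zero_of_isEmpty]
  have hb : ∀ n x, ‖hf.approxBounded C n x‖ ≤ C := fun n x => hf.norm_approxBounded_le (hC0 x) n x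
  have ht : ∀ x, Tendsto (fun n => hf.approxBounded C n x) atTop (𝓝 (f x)) := fun x =>
    hf.tendsto_approxBounded_of_norm_le (hC x)
  have key : Tendsto (fun n => (ν.withDensityᵥ h).integral (hf.approxBounded C n)
      (ContinuousLinearMap.mul ℝ ℂ)) atTop
      (𝓝 ((ν.withDensityᵥ h).integral f (ContinuousLinearMap.mul ℝ ℂ))) :=
    VectorMeasure.tendsto_integral_filter_of_norm_le_const
      (Eventually.of_forall fun n => (hf.approxBounded C n).stronglyMeasurable.aestronglyMeasurable)
      ⟨C, Eventually.of_forall fun n => ae_of_all _ (hb n)⟩ (ae_of_all _ ht)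
  refine tendsto_nhds_unique key ?_
  simp only [hsimple]
  refine tendsto_integral_filter_of_dominated_convergence (fun x => C * ‖h x‖)
    (Eventually.of_forall fun n =>
      (hf.approxBounded C n).stronglyMeasurable.aestronglyMeasurable.mul hh.1)
    (Eventually.of_forall fun n => ae_of_all _ fun x => ?_) (hh.norm.const_mul C)
    (ae_of_all _ fun x => (ht x).mul_const _)
  rw [norm_mul]
  exact mul_le_mul_of_nonneg_right (hb n x) (norm_nonneg _)

end ComplexMeasures

/-! ### Riesz representation for complex functionals on `C(X)` -/

section Riesz

open Filter Topology

variable {X : Type*} [TopologicalSpace X] [CompactSpace X] [TopologicalSpace.MetrizableSpace X]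
  [MeasurableSpace X] [BorelSpace X]

/-- The radial retraction of `ℂ` onto the unit disc moves points towards the points of the disc,
up to a factor `2`. -/
theorem norm_sub_inv_max_smul_le {u g : ℂ} (hu : ‖u‖ ≤ 1) :
    ‖u - (max 1 ‖g‖)⁻¹ • g‖ ≤ 2 * ‖u - g‖ := by
  have h1 : 1 ≤ max 1 ‖g‖ := le_max_left _ _
  have h0 : 0 < max 1 ‖g‖ := by positivity
  -- The retraction moves `g` by `max(0, |g| - 1)`, and `|g| - 1 ≤ |g| - |u|`.
  have h2 : ‖g - (max 1 ‖g‖)⁻¹ • g‖ ≤ ‖u - g‖ := by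
    have e : g - (max 1 ‖g‖)⁻¹ • g = (1 - (max 1 ‖g‖)⁻¹) • g := by rw [sub_smul, one_smul]
    rw [e, norm_smul, Real.norm_of_nonneg (by rw [sub_nonneg]; exact inv_le_one_of_one_le₀ h1)]
    rcases le_total ‖g‖ 1 with hg | hg
    · simp [max_eq_left hg]
    · rw [max_eq_right hg, sub_mul, inv_mul_cancel₀ (by positivity), one_mul]
      have := norm_sub_norm_le g u
      rw [norm_sub_rev g u] at this
      linarith
  calc ‖u - (max 1 ‖g‖)⁻¹ • g‖ = ‖(u - g) + (g - (max 1 ‖g‖)⁻¹ • g)‖ := by congr 1; ring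
    _ ≤ ‖u - g‖ + ‖g - (max 1 ‖g‖)⁻¹ • g‖ := norm_add_le _ _
    _ ≤ 2 * ‖u - g‖ := by linarith

/-- The `L¹` norm of a density is at most the norm of the functional it defines on continuous
functions. -/
theorem integral_norm_le_of_forall_continuousMap {ν : Measure X}
    {h : X → ℂ} (hh : Integrable h ν) {C : ℝ}
    (hC : ∀ f : C(X, ℂ), ‖f‖ ≤ 1 → ‖∫ x, f x * h x ∂ν‖ ≤ C) : ∫ x, ‖h x‖ ∂ν ≤ C := by
  refine le_of_forall_pos_le_add fun ε hε => ?_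
  set ρ : Measure X := ν.withDensity fun x => ‖h x‖ₑ
  have : IsFiniteMeasure ρ := isFiniteMeasure_withDensity hh.2.ne
  -- The phase with `u h = |h|`; where `h = 0` the convention `0⁻¹ = 0` gives `u = 0`.
  set u : X → ℂ := fun x => ((‖h x‖⁻¹ : ℝ) : ℂ) * star (h x)
  have hum : AEStronglyMeasurable u ν :=
    (Complex.continuous_ofReal.comp_aestronglyMeasurable hh.1.norm.inv₀).mul
      (continuous_star.comp_aestronglyMeasurable hh.1)
  have hu1 : ∀ x, ‖u x‖ ≤ 1 := fun x => by
    simp only [u, norm_mul, Complex.norm_real, norm_inv, norm_norm, norm_star]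
    exact inv_mul_le_one
  have huh : ∀ x, u x * h x = (‖h x‖ : ℂ) := fun x => by
    by_cases hx : h x = 0
    · simp [hx]
    · have : (‖h x‖ : ℂ) ≠ 0 := by simpa using hx
      simp only [u, mul_assoc, Complex.star_def, Complex.conj_mul', Complex.ofReal_inv]
      field_simp
  have hui : Integrable u ρ :=
    Integrable.of_bound (hum.mono_ac (withDensity_absolutelyContinuous _ _)) 1 (ae_of_all _ hu1)
  -- Approximation in `L¹(|h| ν)`. Retracting `g` to the unit disc costs a factor `2`, whence `ε /
  -- 2`.
  obtain ⟨g, hg, -⟩ := hui.exists_boundedContinuous_lintegral_sub_le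
    (ε := ENNReal.ofReal (ε / 2)) (by simpa using hε)
  set f : C(X, ℂ) := ⟨fun x => (max 1 ‖g x‖)⁻¹ • g x, by
    refine Continuous.smul (Continuous.inv₀ (continuous_const.max g.continuous.norm) fun x => ?_) g.continuous
    exact (lt_of_lt_of_le one_pos (le_max_left _ _)).ne'⟩ with hf
  have hf1 : ‖f‖ ≤ 1 := by
    refine (ContinuousMap.norm_le _ zero_le_one).2 fun x => ?_
    have h1 : 0 < max 1 ‖g x‖ := lt_of_lt_of_le one_pos (le_max_left _ _)
    simp only [hf, ContinuousMap.coe_mk, norm_smul, norm_inv, Real.norm_of_nonneg h1.le]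
    rw [inv_mul_le_one₀ h1]
    exact le_max_right _ _
  have hfi : Integrable (fun x => f x * h x) ν :=
    hh.bdd_mul f.continuous.aestronglyMeasurable (ae_of_all _ fun x => f.norm_coe_le_norm x)
  have huhi : Integrable (fun x => u x * h x) ν := hh.bdd_mul hum (ae_of_all _ hu1)
  have hdiff : ‖∫ x, (u x - f x) * h x ∂ν‖ₑ ≤ ENNReal.ofReal ε := by
    calc ‖∫ x, (u x - f x) * h x ∂ν‖ₑ ≤ ∫⁻ x, ‖(u x - f x) * h x‖ₑ ∂ν :=
          enorm_integral_le_lintegral_enorm _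
      _ ≤ ∫⁻ x, 2 * (‖h x‖ₑ * ‖u x - g x‖ₑ) ∂ν := by
          refine lintegral_mono fun x => ?_
          rw [enorm_mul, mul_comm, mul_left_comm]
          gcongr
          have := ENNReal.ofReal_le_ofReal (norm_sub_inv_max_smul_le (g := g x) (hu1 x))
          rwa [ENNReal.ofReal_mul zero_le_two, ofReal_norm, ofReal_norm,
            ENNReal.ofReal_ofNat] at this
      _ = 2 * ∫⁻ x, ‖u x - g x‖ₑ ∂ρ := by
          rw [lintegral_const_mul' _ _ (by simp), lintegral_withDensity_eq_lintegral_mul₀ hh.1.enorm]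
          · rfl
          · exact (hum.sub g.continuous.aestronglyMeasurable).enorm
      _ ≤ 2 * ENNReal.ofReal (ε / 2) := by gcongr
      _ = ENNReal.ofReal ε := by
          rw [← ENNReal.ofReal_ofNat, ← ENNReal.ofReal_mul zero_le_two]; congr 1; ring
  have hdiff' : ‖∫ x, (u x - f x) * h x ∂ν‖ ≤ ε := by
    rw [← ofReal_norm] at hdiff
    exact (ENNReal.ofReal_le_ofReal_iff hε.le).1 hdiff
  have e1 : ∫ x, (u x - f x) * h x ∂ν + ∫ x, f x * h x ∂ν = ((∫ x, ‖h x‖ ∂ν : ℝ) : ℂ) := by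
    rw [← integral_complex_ofReal, ← integral_add]
    · exact integral_congr_ae (ae_of_all _ fun x => by simp only [← huh]; ring)
    · simpa [sub_mul, Pi.sub_def] using huhi.sub hfi
    · exact hfi
  calc ∫ x, ‖h x‖ ∂ν ≤ ‖((∫ x, ‖h x‖ ∂ν : ℝ) : ℂ)‖ := by
        rw [Complex.norm_real]; exact le_abs_self _
    _ ≤ C + ε := by
        rw [← e1]
        exact (norm_add_le _ _).trans (by linarith [hC f hf1])


open scoped NNReal

omit [TopologicalSpace.MetrizableSpace X] [MeasurableSpace X] [BorelSpace X] in
theorem norm_functional_le_of_nnnorm_le (Λ : C(X, ℂ) →L[ℂ] ℂ) (f : C(X, ℝ≥0)) :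
    ∃ N : ℝ≥0, ∀ g : C(X, ℂ), (∀ x, ‖g x‖₊ ≤ f x) → ‖Λ g‖₊ ≤ N := by
  obtain ⟨N, hN⟩ := (isCompact_range f.continuous).bddAbove
  refine ⟨‖Λ‖₊ * N, fun g hg => (Λ.le_opNNNorm g).trans ?_⟩
  gcongr
  exact (ContinuousMap.norm_le _ N.2).2 fun x => (hg x).trans (hN ⟨x, rfl⟩)

/-- The total variation of a functional, `|Λ|(f) = sup {|Λ g| : |g| ≤ f}`. -/
def absFunctional (Λ : C(X, ℂ) →L[ℂ] ℂ) (f : C(X, ℝ≥0)) : ℝ≥0 :=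
  sSup ((fun g : C(X, ℂ) => ‖Λ g‖₊) '' {g | ∀ x, ‖g x‖₊ ≤ f x})

omit [TopologicalSpace.MetrizableSpace X] [MeasurableSpace X] [BorelSpace X] in
theorem le_absFunctional (Λ : C(X, ℂ) →L[ℂ] ℂ) {f : C(X, ℝ≥0)} {g : C(X, ℂ)}
    (hg : ∀ x, ‖g x‖₊ ≤ f x) : ‖Λ g‖₊ ≤ absFunctional Λ f := by
  obtain ⟨N, hN⟩ := norm_functional_le_of_nnnorm_le Λ f
  exact le_csSup ⟨N, by rintro _ ⟨g, hg, rfl⟩; exact hN g hg⟩ ⟨g, hg, rfl⟩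

omit [CompactSpace X] [TopologicalSpace.MetrizableSpace X] [MeasurableSpace X] [BorelSpace X] in
theorem absFunctional_le (Λ : C(X, ℂ) →L[ℂ] ℂ) {f : C(X, ℝ≥0)} {N : ℝ≥0}
    (h : ∀ g : C(X, ℂ), (∀ x, ‖g x‖₊ ≤ f x) → ‖Λ g‖₊ ≤ N) : absFunctional Λ f ≤ N :=
  csSup_le ⟨_, 0, by simp, rfl⟩ (by rintro _ ⟨g, hg, rfl⟩; exact h g hg)

omit [TopologicalSpace.MetrizableSpace X] [MeasurableSpace X] [BorelSpace X] in
theorem absFunctional_smul_le (Λ : C(X, ℂ) →L[ℂ] ℂ) (c : ℝ≥0) (f : C(X, ℝ≥0)) :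
    c * absFunctional Λ f ≤ absFunctional Λ (c • f) := by
  rcases eq_or_ne c 0 with rfl | hc
  · simp
  rw [mul_comm, ← le_div_iff₀ (pos_iff_ne_zero.2 hc)]
  refine absFunctional_le Λ fun g hg => ?_
  rw [le_div_iff₀ (pos_iff_ne_zero.2 hc), mul_comm]
  have := le_absFunctional Λ (f := c • f) (g := ((c : ℝ) : ℂ) • g) fun x => by
    simp only [ContinuousMap.smul_apply, smul_eq_mul, nnnorm_mul, Complex.nnnorm_real,
      NNReal.nnnorm_eq]
    exact mul_le_mul_right (hg x) c
  simpa [nnnorm_mul, Complex.nnnorm_real] using this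

omit [TopologicalSpace.MetrizableSpace X] [MeasurableSpace X] [BorelSpace X] in
theorem absFunctional_smul (Λ : C(X, ℂ) →L[ℂ] ℂ) (c : ℝ≥0) (f : C(X, ℝ≥0)) :
    absFunctional Λ (c • f) = c * absFunctional Λ f := by
  refine le_antisymm ?_ (absFunctional_smul_le Λ c f)
  rcases eq_or_ne c 0 with rfl | hc
  · refine absFunctional_le Λ fun g hg => ?_
    have : g = 0 := by ext x; simpa using hg x
    simp [this]
  have := absFunctional_smul_le Λ c⁻¹ (c • f)
  rwa [smul_smul, inv_mul_cancel₀ hc, one_smul, inv_mul_le_iff₀ (pos_iff_ne_zero.2 hc)] at this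

omit [TopologicalSpace.MetrizableSpace X] [MeasurableSpace X] [BorelSpace X] in
-- Additivity is what makes `|Λ|` a positive functional to which the Riesz–Markov–Kakutani theorem
-- applies. For `≤`, a competitor `g` is split in the proportion `f₁ : f₂`; for `≥`, competitors of
-- `f₁` and `f₂` are rotated so that their values under `Λ` add without cancellation.
theorem absFunctional_add (Λ : C(X, ℂ) →L[ℂ] ℂ) (f₁ f₂ : C(X, ℝ≥0)) :
    absFunctional Λ (f₁ + f₂) = absFunctional Λ f₁ + absFunctional Λ f₂ := by
  apply le_antisymm
  · refine absFunctional_le Λ fun g hg => ?_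
    refine le_of_forall_pos_le_add fun ε hε => ?_
    -- The shift by `δ` keeps the denominator `f₁ + f₂ + δ` away from zero; the third piece of `g`
    -- it creates contributes at most `‖Λ‖ δ ≤ ε`.
    set δ : ℝ≥0 := ε / (‖Λ‖₊ + 1)
    have hδ : 0 < δ := by positivity
    have hpos : ∀ x, (((f₁ x + f₂ x + δ : ℝ≥0) : ℝ) : ℂ) ≠ 0 := fun x => by
      have : 0 < f₁ x + f₂ x + δ := by positivity
      exact_mod_cast this.ne'
    let w : C(X, ℝ≥0) → C(X, ℂ) := fun k =>
      ⟨fun x => g x * ((k x : ℝ) : ℂ) / (((f₁ x + f₂ x + δ : ℝ≥0) : ℝ) : ℂ), by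
        refine Continuous.div (by fun_prop) (by fun_prop) hpos⟩
    have hw : ∀ k x, ‖w k x‖₊ ≤ k x := fun k x => by
      have h0 : 0 < f₁ x + f₂ x + δ := by positivity
      simp only [w, ContinuousMap.coe_mk, nnnorm_div, nnnorm_mul, Complex.nnnorm_real,
        NNReal.nnnorm_eq]
      rw [div_le_iff₀ h0, mul_comm]
      gcongr
      exact (hg x).trans (by simp)
    have hsum : g = w f₁ + w f₂ + w (ContinuousMap.const X δ) := by
      ext x
      have := hpos x
      simp only [w, ContinuousMap.add_apply, ContinuousMap.coe_mk, ContinuousMap.const_apply]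
      rw [← add_div, ← add_div, ← mul_add, ← mul_add, eq_div_iff this]
      push_cast
      ring
    have h3 : ‖Λ (w (ContinuousMap.const X δ))‖₊ ≤ ε := by
      refine (Λ.le_opNNNorm _).trans ?_
      have : ‖w (ContinuousMap.const X δ)‖₊ ≤ δ :=
        (ContinuousMap.norm_le _ δ.2).2 fun x => hw (ContinuousMap.const X δ) x
      calc ‖Λ‖₊ * ‖w (ContinuousMap.const X δ)‖₊ ≤ (‖Λ‖₊ + 1) * δ := by
            gcongr; simp
        _ = ε := by rw [mul_div_cancel₀]; positivity
    calc ‖Λ g‖₊ = ‖Λ (w f₁) + Λ (w f₂) + Λ (w (ContinuousMap.const X δ))‖₊ := by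
          rw [← map_add, ← map_add, ← hsum]
      _ ≤ ‖Λ (w f₁)‖₊ + ‖Λ (w f₂)‖₊ + ‖Λ (w (ContinuousMap.const X δ))‖₊ :=
          (nnnorm_add_le _ _).trans (by gcongr; exact nnnorm_add_le _ _)
      _ ≤ absFunctional Λ f₁ + absFunctional Λ f₂ + ε := by
          gcongr
          · exact le_absFunctional Λ (hw f₁)
          · exact le_absFunctional Λ (hw f₂)
  · have key : ∀ g₁ g₂ : C(X, ℂ), (∀ x, ‖g₁ x‖₊ ≤ f₁ x) → (∀ x, ‖g₂ x‖₊ ≤ f₂ x) →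
        ‖Λ g₁‖₊ + ‖Λ g₂‖₊ ≤ absFunctional Λ (f₁ + f₂) := by
      intro g₁ g₂ h₁ h₂
      obtain ⟨c₁, hc₁, e₁⟩ := RCLike.exists_norm_eq_mul_self (Λ g₁)
      obtain ⟨c₂, hc₂, e₂⟩ := RCLike.exists_norm_eq_mul_self (Λ g₂)
      have e : ‖Λ (c₁ • g₁ + c₂ • g₂)‖₊ = ‖Λ g₁‖₊ + ‖Λ g₂‖₊ := by
        apply NNReal.eq
        rw [map_add, map_smul, map_smul, smul_eq_mul, smul_eq_mul, ← e₁, ← e₂]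
        push_cast
        rw [← RCLike.ofReal_add, RCLike.norm_ofReal, abs_of_nonneg (by positivity)]
      rw [← e]
      refine le_absFunctional Λ fun x => ?_
      have hc₁' : ‖c₁‖₊ = 1 := NNReal.eq hc₁
      have hc₂' : ‖c₂‖₊ = 1 := NNReal.eq hc₂
      refine (nnnorm_add_le _ _).trans ?_
      simp only [ContinuousMap.smul_apply, nnnorm_smul, hc₁', hc₂', one_mul,
        ContinuousMap.add_apply]
      exact add_le_add (h₁ x) (h₂ x)
    have h1 : ∀ g₂ : C(X, ℂ), (∀ x, ‖g₂ x‖₊ ≤ f₂ x) →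
        absFunctional Λ f₁ + ‖Λ g₂‖₊ ≤ absFunctional Λ (f₁ + f₂) := by
      intro g₂ h₂
      have hle : ‖Λ g₂‖₊ ≤ absFunctional Λ (f₁ + f₂) := by
        simpa using key 0 g₂ (by simp) h₂
      rw [← le_tsub_iff_right hle]
      exact absFunctional_le Λ fun g₁ h₁ => (le_tsub_iff_right hle).2 (key g₁ g₂ h₁ h₂)
    have hle : absFunctional Λ f₁ ≤ absFunctional Λ (f₁ + f₂) := by
      simpa using h1 0 (by simp)
    rw [← le_tsub_iff_left hle]
    exact absFunctional_le Λ fun g₂ h₂ => (le_tsub_iff_left hle).2 (h1 g₂ h₂)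

omit [BorelSpace X] in
/-- A bounded functional on `C(X)` is dominated by the `L¹` norm of a finite measure. -/
theorem exists_measure_norm_le_integral [BorelSpace X] (Λ : C(X, ℂ) →L[ℂ] ℂ) :
    ∃ ν : Measure X, IsFiniteMeasure ν ∧ ∀ g : C(X, ℂ), ‖Λ g‖ ≤ ∫ x, ‖g x‖ ∂ν := by
  let P : CompactlySupportedContinuousMap X ℝ≥0 →ₗ[ℝ≥0] ℝ≥0 :=
    { toFun := fun f => absFunctional Λ f.toContinuousMap
      map_add' := fun f₁ f₂ => absFunctional_add Λ f₁.toContinuousMap f₂.toContinuousMap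
      map_smul' := fun c f => absFunctional_smul Λ c f.toContinuousMap }
  have hfin : IsFiniteMeasure (NNRealRMK.rieszMeasure P) := by
    constructor
    have h := NNRealRMK.lintegral_rieszMeasure P
      (CompactlySupportedContinuousMap.continuousMapEquiv (ContinuousMap.const X 1))
    simp only [CompactlySupportedContinuousMap.continuousMapEquiv_apply_toFun,
      ContinuousMap.const_apply, ENNReal.coe_one, lintegral_const, one_mul] at h
    rw [h]
    exact ENNReal.coe_lt_top
  refine ⟨NNRealRMK.rieszMeasure P, hfin, fun g => ?_⟩
  have h := NNRealRMK.integral_rieszMeasure P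
    (CompactlySupportedContinuousMap.continuousMapEquiv ⟨fun x => ‖g x‖₊, by fun_prop⟩)
  simp only [CompactlySupportedContinuousMap.continuousMapEquiv_apply_toFun,
    ContinuousMap.coe_mk, coe_nnnorm] at h
  rw [h]
  exact_mod_cast le_absFunctional Λ fun x => le_rfl

/-- **Riesz representation theorem** for bounded functionals on `C(X, ℂ)`. -/
theorem exists_integrable_forall_eq_integral (Λ : C(X, ℂ) →L[ℂ] ℂ) :
    ∃ (ν : Measure X) (h : X → ℂ), IsFiniteMeasure ν ∧ Integrable h ν ∧
      ∀ g : C(X, ℂ), Λ g = ∫ x, g x * h x ∂ν := by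
  obtain ⟨ν, hν, hΛ⟩ := exists_measure_norm_le_integral Λ
  let e : C(X, ℂ) →ₗ[ℂ] Lp ℂ 2 ν := (ContinuousMap.toLp 2 ν ℂ : C(X, ℂ) →L[ℂ] Lp ℂ 2 ν)
  have hd : DenseRange e := ContinuousMap.toLp_denseRange ℂ ν ℂ (by simp)
  -- On a finite measure the `L¹` norm is bounded by a multiple of the `L²` norm, so `Λ` extends to
  -- `L²(ν)` and the Hilbert space Riesz theorem supplies the density.
  have hb : ∀ g : C(X, ℂ), ‖(Λ : C(X, ℂ) →ₗ[ℂ] ℂ) g‖ ≤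
      (ν Set.univ ^ (1 / (1 : ℝ≥0∞).toReal - 1 / (2 : ℝ≥0∞).toReal)).toReal * ‖e g‖ := by
    intro g
    refine (hΛ g).trans ?_
    have h1 := eLpNorm_le_eLpNorm_mul_rpow_measure_univ (μ := ν) (p := 1) (q := 2) (f := g)
      (by norm_num) g.continuous.aestronglyMeasurable
    have h2 : ‖e g‖ = (eLpNorm g 2 ν).toReal := by
      rw [Lp.norm_def]
      exact congrArg _ (eLpNorm_congr_ae (ContinuousMap.coeFn_toLp (𝕜 := ℂ) ν g))
    have hm : MemLp g 2 ν :=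
      (memLp_congr_ae (ContinuousMap.coeFn_toLp (𝕜 := ℂ) ν g)).1 (Lp.memLp (e g))
    rw [integral_norm_eq_lintegral_enorm g.continuous.aestronglyMeasurable,
      ← eLpNorm_one_eq_lintegral_enorm, h2, mul_comm, ← ENNReal.toReal_mul]
    refine ENNReal.toReal_mono (ENNReal.mul_ne_top hm.2.ne ?_) h1
    exact ENNReal.rpow_ne_top_of_nonneg (by norm_num) (measure_ne_top _ _)
  let Φ : Lp ℂ 2 ν →L[ℂ] ℂ := (Λ : C(X, ℂ) →ₗ[ℂ] ℂ).extendOfNorm e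
  obtain ⟨k, hk⟩ := (InnerProductSpace.toDual ℂ (Lp ℂ 2 ν)).surjective Φ
  refine ⟨ν, fun x => star (k x), hν, ?_, fun g => ?_⟩
  · have := (Lp.memLp k).integrable (by norm_num)
    exact ⟨continuous_star.comp_aestronglyMeasurable this.1, this.2.congr' (ae_of_all _ fun x => (norm_star _).symm)⟩
  · have h1 : Φ (e g) = Λ g := LinearMap.extendOfNorm_eq hd ⟨_, hb⟩ g
    rw [← h1, ← hk, InnerProductSpace.toDual_apply_apply, L2.inner_def]
    refine integral_congr_ae ?_
    filter_upwards [ContinuousMap.coeFn_toLp (p := 2) (𝕜 := ℂ) ν g] with x hx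
    have hx' : e g x = g x := hx
    simp [hx']

end Riesz

/-! ### Bounded symbols and measures on the torus -/

section TorusMeasures

open UnitAddTorus

variable {d : ℕ}

/-- The functional `χ₋ₘ ↦ φ(m)` on trigonometric polynomials has norm at most `C`. -/
def SymbolBound (φ : (Fin d → ℤ) → ℂ) (C : ℝ) : Prop :=
  ∀ c : (Fin d → ℤ) →₀ ℂ, ‖c.sum fun m a => a * φ m‖ ≤
    C * ‖(c.sum fun m a => a • mFourier (-m) : C(UnitAddTorus (Fin d), ℂ))‖

theorem denseRange_linearCombination_mFourier_neg :
    DenseRange (Finsupp.linearCombination ℂ fun m : Fin d → ℤ =>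
      (mFourier (-m) : C(UnitAddTorus (Fin d), ℂ))) := by
  have h1 : Set.range (fun m : Fin d → ℤ => (mFourier (-m) : C(UnitAddTorus (Fin d), ℂ))) =
      Set.range mFourier := (Equiv.neg _).surjective.range_comp mFourier
  have h2 := span_mFourier_closure_eq_top (d := Fin d)
  rw [← h1, ← Finsupp.range_linearCombination] at h2
  rw [DenseRange, dense_iff_closure_eq]
  exact congrArg (fun S : Submodule ℂ C(UnitAddTorus (Fin d), ℂ) =>
    (S : Set C(UnitAddTorus (Fin d), ℂ))) h2

/-- The bound makes the functional well defined on trigonometric polynomials, and it extends to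
`C(𝕋^d)` by density with the same constant. -/
theorem SymbolBound.exists_functional {φ : (Fin d → ℤ) → ℂ} {C : ℝ} (h : SymbolBound φ C) :
    ∃ Λ : C(UnitAddTorus (Fin d), ℂ) →L[ℂ] ℂ, (∀ m, Λ (mFourier (-m)) = φ m) ∧
      ∀ f, ‖Λ f‖ ≤ C * ‖f‖ := by
  have hb : ∀ c, ‖Finsupp.linearCombination ℂ φ c‖ ≤ C * ‖Finsupp.linearCombination ℂ
      (fun m : Fin d → ℤ => (mFourier (-m) : C(UnitAddTorus (Fin d), ℂ))) c‖ := h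
  refine ⟨(Finsupp.linearCombination ℂ φ).extendOfNorm (Finsupp.linearCombination ℂ
      fun m : Fin d → ℤ => (mFourier (-m) : C(UnitAddTorus (Fin d), ℂ))), fun m => ?_,
    LinearMap.norm_extendOfNorm_apply_le denseRange_linearCombination_mFourier_neg C hb⟩
  have := LinearMap.extendOfNorm_eq denseRange_linearCombination_mFourier_neg ⟨C, hb⟩
    (Finsupp.single m 1)
  simpa using this

theorem fourierTransform_withDensityᵥ {ν : Measure (UnitAddTorus (Fin d))}
    {h : UnitAddTorus (Fin d) → ℂ} (hh : Integrable h ν) (m : Fin d → ℤ) :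
    ClassicalTorus.fourierTransform (ν.withDensityᵥ h) m = ∫ t, mFourier (-m) t * h t ∂ν :=
  integral_withDensityᵥ hh (mFourier (-m)).continuous.stronglyMeasurable
    (mFourier (-m)).norm_coe_le_norm

/-- A bounded symbol is the Fourier transform of a complex measure. -/
theorem SymbolBound.exists_fourierTransform_eq {φ : (Fin d → ℤ) → ℂ} {C : ℝ}
    (h : SymbolBound φ C) : ∃ μ, ClassicalTorus.fourierTransform μ = φ := by
  obtain ⟨Λ, hΛ, -⟩ := h.exists_functional
  obtain ⟨ν, k, hν, hk, hint⟩ := exists_integrable_forall_eq_integral Λ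
  refine ⟨ν.withDensityᵥ k, funext fun m => ?_⟩
  rw [fourierTransform_withDensityᵥ hk, ← hint, hΛ]

/-- The total variation of a complex measure is at most the norm of its symbol. -/
theorem SymbolBound.variation_le {μ : ComplexMeasure (UnitAddTorus (Fin d))} {C : ℝ}
    (hC : SymbolBound (ClassicalTorus.fourierTransform μ) C) :
    μ.variation Set.univ ≤ ENNReal.ofReal C := by
  obtain ⟨ν, h, hν, hh, rfl⟩ := μ.exists_eq_withDensityᵥ
  obtain ⟨Λ, hΛ, hΛC⟩ := hC.exists_functional
  have hint : ∀ f : C(UnitAddTorus (Fin d), ℂ), Integrable (fun x => f x * h x) ν := fun f =>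
    hh.bdd_mul f.continuous.aestronglyMeasurable (ae_of_all _ fun x => f.norm_coe_le_norm x)
  let I : C(UnitAddTorus (Fin d), ℂ) →ₗ[ℂ] ℂ :=
    { toFun := fun f => ∫ x, f x * h x ∂ν
      map_add' := fun f g => by
        rw [← integral_add (hint f) (hint g)]
        simp [add_mul]
      map_smul' := fun c f => by
        rw [RingHom.id_apply, ← integral_smul]
        simp [mul_assoc] }
  let J : C(UnitAddTorus (Fin d), ℂ) →L[ℂ] ℂ := I.mkContinuous (∫ x, ‖h x‖ ∂ν) fun f => by
    rw [← integral_mul_const]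
    refine norm_integral_le_of_norm_le (hh.norm.mul_const _) (ae_of_all _ fun x => ?_)
    rw [norm_mul, mul_comm]
    exact mul_le_mul_of_nonneg_left (f.norm_coe_le_norm x) (norm_nonneg _)
  -- Two continuous functionals that agree on the characters, whose span is dense.
  have hJ : J = Λ := by
    refine ContinuousLinearMap.ext_on (s := Set.range fun m : Fin d → ℤ => mFourier (-m)) ?_ ?_
    · rw [← Finsupp.range_linearCombination]
      exact denseRange_linearCombination_mFourier_neg
    · rintro _ ⟨m, rfl⟩
      rw [hΛ, fourierTransform_withDensityᵥ hh]
      rfl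
  have hC0 : 0 ≤ C := by
    have := (norm_nonneg _).trans (hΛC 1)
    simpa using this
  have key : ∫ x, ‖h x‖ ∂ν ≤ C := integral_norm_le_of_forall_continuousMap hh fun f hf => by
    have h1 : ∫ x, f x * h x ∂ν = Λ f := congrArg (fun L => L f) hJ
    rw [h1]
    exact (hΛC f).trans (mul_le_of_le_one_right hC0 hf)
  rw [Measure.variation_withDensityᵥ hh, withDensity_apply _ MeasurableSet.univ,
    Measure.restrict_univ, ← ofReal_integral_norm_eq_lintegral_enorm hh]
  exact ENNReal.ofReal_le_ofReal key

end TorusMeasures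

/-! ### Norms of operator matrices and averages of unitary conjugations -/

section OperatorBounds

variable {H : Type*} [NormedAddCommGroup H] [InnerProductSpace ℂ H]
variable {K : Type*} [NormedAddCommGroup K] [InnerProductSpace ℂ K]
variable {E : Type*} [AddCommGroup E] [Module ℂ E]
variable {F : Type*} [AddCommGroup F] [Module ℂ F]

/-- The mean of squares in place of `‖y‖ ‖x‖` suits forms written as integrals: sums of squares
integrate exactly by Parseval, with no Cauchy–Schwarz inequality for integrals. On unit vectors the
two bounds agree, and `y = A x / ‖A x‖` recovers the norm. -/
theorem opNorm_le_of_norm_inner_le {A : H →L[ℂ] H} {M : ℝ} (hM : 0 ≤ M)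
    (h : ∀ x y, ‖inner ℂ y (A x)‖ ≤ M * ((‖y‖ ^ 2 + ‖x‖ ^ 2) / 2)) : ‖A‖ ≤ M := by
  refine ContinuousLinearMap.opNorm_le_of_unit_norm (𝕜 := ℂ) hM fun x hx => ?_
  rcases eq_or_ne (A x) 0 with h0 | h0
  · simpa [h0] using hM
  have hn : (0 : ℝ) < ‖A x‖ := norm_pos_iff.2 h0
  have h1 := h x (((‖A x‖⁻¹ : ℝ) : ℂ) • A x)
  rw [inner_smul_left, inner_self_eq_norm_sq_to_K, norm_smul, Complex.norm_real, norm_inv,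
    norm_norm, inv_mul_cancel₀ hn.ne', hx] at h1
  simp only [Complex.conj_ofReal, norm_mul, Complex.norm_real, norm_inv, norm_norm, norm_pow,
    Complex.coe_algebraMap] at h1
  rw [sq ‖A x‖, inv_mul_cancel_left₀ hn.ne'] at h1
  linarith

theorem matrixOperator_apply {n : ℕ} (a : Matrix (Fin n) (Fin n) (H →L[ℂ] H))
    (ξ : PiLp 2 fun _ : Fin n => H) (i : Fin n) :
    matrixOperator a ξ i = ∑ j, a i j (ξ j) := by
  simp [matrixOperator]

theorem inner_matrixOperator {n : ℕ} (a : Matrix (Fin n) (Fin n) (H →L[ℂ] H))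
    (ξ η : PiLp 2 fun _ : Fin n => H) :
    inner ℂ η (matrixOperator a ξ) = ∑ i, ∑ j, inner ℂ (η i) (a i j (ξ j)) := by
  simp only [PiLp.inner_apply, matrixOperator_apply, inner_sum]

theorem matrixOperator_smul {n : ℕ} (c : ℂ) (a : Matrix (Fin n) (Fin n) (H →L[ℂ] H)) :
    matrixOperator (c • a) = c • matrixOperator a := by
  ext ξ i
  simp [matrixOperator_apply, Finset.smul_sum]

theorem enorm_smul_continuousLinearMap (c : ℂ) (A : H →L[ℂ] H) : ‖c • A‖ₑ = ‖c‖ₑ * ‖A‖ₑ := by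
  rw [← ofReal_norm, norm_smul, ENNReal.ofReal_mul (norm_nonneg _), ofReal_norm, ofReal_norm]

/-- Rescaling by `M⁻¹` brings the matrix into the unit ball over which the cb norm is a supremum;
hence the strict positivity of `M`. -/
theorem matrixNorm_map_le_cbNorm_mul (ρ : E →ₗ[ℂ] H →L[ℂ] H) (σ : F →ₗ[ℂ] K →L[ℂ] K)
    (u : E →ₗ[ℂ] F) {n : ℕ} (a : Matrix (Fin n) (Fin n) E) {M : ℝ} (hM : 0 < M)
    (ha : ‖matrixOperator (a.map ρ)‖ ≤ M) :
    matrixNorm σ (a.map u) ≤ cbNorm ρ σ u * ENNReal.ofReal M := by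
  set c : ℂ := ((M⁻¹ : ℝ) : ℂ)
  have hc : ‖c‖ₑ = ENNReal.ofReal M⁻¹ := by
    rw [← ofReal_norm, Complex.norm_real, Real.norm_of_nonneg (by positivity)]
  have e1 : (c • a).map ρ = c • a.map ρ := by ext; simp
  have e2 : ((c • a).map u).map σ = c • (a.map u).map σ := by ext; simp
  have hn : matrixNorm ρ (c • a) ≤ 1 := by
    rw [matrixNorm, e1, matrixOperator_smul, enorm_smul_continuousLinearMap, hc, ← ofReal_norm,
      ← ENNReal.ofReal_mul (by positivity), ENNReal.ofReal_le_one]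
    rwa [inv_mul_le_iff₀ hM, mul_one]
  have h1 : matrixNorm σ ((c • a).map u) ≤ cbNorm ρ σ u :=
    le_iSup_of_le n (le_iSup_of_le (c • a) (le_iSup_of_le hn le_rfl))
  rw [matrixNorm, e2, matrixOperator_smul, enorm_smul_continuousLinearMap, hc, ENNReal.ofReal_inv_of_pos hM] at h1
  rw [← ENNReal.div_le_iff_le_mul (by simp [hM]) (by simp), div_eq_mul_inv, mul_comm]
  exact h1

/-- An average of unitary conjugations against a density is completely bounded by the `L¹` norm of
the density. -/
theorem cbNorm_le_of_inner_eq_integral {Z : Type*} [MeasurableSpace Z] {ν : Measure Z} {h : Z → ℂ}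
    (hh : Integrable h ν) (W : Z → H ≃ₗᵢ[ℂ] H) (ρ : E →ₗ[ℂ] H →L[ℂ] H) (T : E →ₗ[ℂ] E)
    (hi : ∀ x ξ η, Integrable (fun z => h z * inner ℂ (W z η) (ρ x (W z ξ))) ν)
    (hT : ∀ x ξ η, inner ℂ η (ρ (T x) ξ) = ∫ z, h z * inner ℂ (W z η) (ρ x (W z ξ)) ∂ν) :
    cbNorm ρ ρ T ≤ ENNReal.ofReal (∫ z, ‖h z‖ ∂ν) := by
  refine iSup_le fun n => iSup_le fun a => iSup_le fun ha => ?_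
  have ha' : ‖matrixOperator (a.map ρ)‖ ≤ 1 := by
    rw [matrixNorm, ← ofReal_norm] at ha
    exact ENNReal.ofReal_le_one.1 ha
  rw [matrixNorm, ← ofReal_norm]
  refine ENNReal.ofReal_le_ofReal (opNorm_le_of_norm_inner_le
    (integral_nonneg fun z => norm_nonneg _) fun ξ η => ?_)
  -- The diagonal amplification of `W z`, isometric on `ℓ₂ⁿ(H)`, through which the whole matrix is
  -- averaged at once.
  set Wn : Z → (PiLp 2 fun _ : Fin n => H) → PiLp 2 fun _ : Fin n => H :=
    fun z ξ => WithLp.toLp 2 fun i => W z (ξ i)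
  have hWn : ∀ z ξ, ‖Wn z ξ‖ = ‖ξ‖ := fun z ξ => by
    simp [PiLp.norm_eq_of_L2, Wn]
  have e1 : inner ℂ η (matrixOperator ((a.map T).map ρ) ξ) =
      ∫ z, h z * inner ℂ (Wn z η) (matrixOperator (a.map ρ) (Wn z ξ)) ∂ν := by
    have hij : ∀ i j, Integrable (fun z => h z * inner ℂ (W z (η i)) (ρ (a i j) (W z (ξ j)))) ν :=
      fun i j => hi _ _ _
    calc _ = ∑ i, ∑ j, ∫ z, h z * inner ℂ (W z (η i)) (ρ (a i j) (W z (ξ j))) ∂ν := by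
          rw [inner_matrixOperator]
          exact Finset.sum_congr rfl fun i _ => Finset.sum_congr rfl fun j _ => hT _ _ _
      _ = ∑ i, ∫ z, ∑ j, h z * inner ℂ (W z (η i)) (ρ (a i j) (W z (ξ j))) ∂ν :=
          Finset.sum_congr rfl fun i _ => (integral_finsetSum _ fun j _ => hij i j).symm
      _ = ∫ z, ∑ i, ∑ j, h z * inner ℂ (W z (η i)) (ρ (a i j) (W z (ξ j))) ∂ν :=
          (integral_finsetSum _ fun i _ => integrable_finsetSum _ fun j _ => hij i j).symm
      _ = _ := by
          refine integral_congr_ae (ae_of_all _ fun z => ?_)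
          simp only [inner_matrixOperator, Finset.mul_sum]
          rfl
  rw [e1, ← integral_mul_const]
  refine norm_integral_le_of_norm_le (hh.norm.mul_const _) (ae_of_all _ fun z => ?_)
  rw [norm_mul]
  gcongr
  refine (norm_inner_le_norm _ _).trans ?_
  have h2 := (matrixOperator (a.map ρ)).le_of_opNorm_le ha' (Wn z ξ)
  rw [one_mul, hWn] at h2
  rw [hWn]
  nlinarith [norm_nonneg η, norm_nonneg ξ, sq_nonneg (‖η‖ - ‖ξ‖),
    mul_le_mul_of_nonneg_left h2 (norm_nonneg η)]

end OperatorBounds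

/-! ### Toeplitz matrices and the transference inequality -/

section Toeplitz

open UnitAddTorus ClassicalTorus

variable {d : ℕ} {H : Type*} [NormedAddCommGroup H] [InnerProductSpace ℂ H]

theorem integral_mFourier (m : Fin d → ℤ) :
    ∫ t, mFourier m t ∂(haar d) = if m = 0 then 1 else 0 := by
  have h := (orthonormal_iff_ite.1 (orthonormal_mFourier (d := Fin d))) 0 m
  simp only [ContinuousMap.inner_toLp, ← mFourier_neg, ← mFourier_add, neg_zero, add_zero] at h
  simp only [eq_comm (a := m)]
  exact h

theorem integrable_continuousMap (f : C(UnitAddTorus (Fin d), ℂ)) : Integrable f (haar d) :=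
  Integrable.of_bound f.continuous.aestronglyMeasurable ‖f‖ (ae_of_all _ f.norm_coe_le_norm)

/-- Parseval for vector-valued polynomials; injectivity of `s` prevents two coefficients from
sharing a frequency. -/
theorem integral_norm_sq_sum_mFourier {n : ℕ} {s : Fin n → Fin d → ℤ} (hs : Function.Injective s)
    (η : Fin n → H) :
    ∫ t, ‖∑ j, mFourier (-s j) t • η j‖ ^ 2 ∂(haar d) = ∑ j, ‖η j‖ ^ 2 := by
  have e1 : ∀ t, ((‖∑ j, mFourier (-s j) t • η j‖ ^ 2 : ℝ) : ℂ) =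
      ∑ i, ∑ j, mFourier (s i - s j) t * inner ℂ (η i) (η j) := by
    intro t
    have := inner_self_eq_norm_sq_to_K (𝕜 := ℂ) (∑ j, mFourier (-s j) t • η j)
    rw [Complex.ofReal_pow]
    refine this.symm.trans ?_
    rw [sum_inner]
    refine Finset.sum_congr rfl fun i _ => ?_
    rw [inner_sum]
    refine Finset.sum_congr rfl fun j _ => ?_
    rw [inner_smul_left, inner_smul_right, ← mFourier_neg, neg_neg, ← mul_assoc, ← mFourier_add,
      ← sub_eq_add_neg]
  apply Complex.ofReal_injective
  have hint : ∀ i j, Integrable (fun t => mFourier (s i - s j) t * inner ℂ (η i) (η j)) (haar d) :=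
    fun i j => (integrable_continuousMap _).mul_const _
  rw [← integral_complex_ofReal]
  simp only [e1]
  rw [integral_finsetSum _ fun i _ => integrable_finsetSum _ fun j _ => hint i j]
  push_cast
  refine Finset.sum_congr rfl fun i _ => ?_
  rw [integral_finsetSum _ fun j _ => hint i j, Finset.sum_eq_single i]
  · rw [integral_mul_const, integral_mFourier, sub_self, if_pos rfl, one_mul]
    exact inner_self_eq_norm_sq_to_K (𝕜 := ℂ) (η i)
  · intro j _ hji
    rw [integral_mul_const, integral_mFourier, if_neg (sub_ne_zero.2 fun h => hji (hs h).symm),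
      zero_mul]
  · simp

theorem integral_mFourier_mul_trigPoly (c : (Fin d → ℤ) →₀ ℂ) (m : Fin d → ℤ) :
    ∫ t, mFourier m t * (c.sum fun m a => a • mFourier (-m) : C(UnitAddTorus (Fin d), ℂ)) t
      ∂(haar d) = c m := by
  have e1 : ∀ t, mFourier m t *
      (c.sum fun m a => a • mFourier (-m) : C(UnitAddTorus (Fin d), ℂ)) t =
      ∑ k ∈ c.support, c k * mFourier (m - k) t := by
    intro t
    rw [Finsupp.sum, ContinuousMap.coe_sum, Finset.sum_apply, Finset.mul_sum]
    refine Finset.sum_congr rfl fun k _ => ?_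
    rw [sub_eq_add_neg, mFourier_add]
    simp only [ContinuousMap.smul_apply, smul_eq_mul]
    ring
  simp only [e1]
  rw [integral_finsetSum _ fun k _ => (integrable_continuousMap _).const_mul _]
  simp only [integral_const_mul, integral_mFourier, sub_eq_zero]
  simp only [mul_ite, mul_one, mul_zero, Finset.sum_ite_eq, Finsupp.mem_support_iff, ne_eq,
    ite_not, ite_eq_right_iff]
  exact fun h => h.symm

/-- The Toeplitz form of a trigonometric polynomial is bounded by its supremum norm. -/
theorem norm_toeplitzForm_le (c : (Fin d → ℤ) →₀ ℂ) {n : ℕ} {s : Fin n → Fin d → ℤ}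
    (hs : Function.Injective s) (ζ η : Fin n → H) :
    ‖∑ i, ∑ j, c (s i - s j) * inner ℂ (ζ i) (η j)‖ ≤
      ‖(c.sum fun m a => a • mFourier (-m) : C(UnitAddTorus (Fin d), ℂ))‖ *
        ((∑ i, ‖ζ i‖ ^ 2 + ∑ j, ‖η j‖ ^ 2) / 2) := by
  set f := (c.sum fun m a => a • mFourier (-m) : C(UnitAddTorus (Fin d), ℂ))
  have e1 : ∀ t, ∑ i, ∑ j, (mFourier (s i - s j) t * f t) * inner ℂ (ζ i) (η j) =
      f t * inner ℂ (∑ i, mFourier (-s i) t • ζ i) (∑ j, mFourier (-s j) t • η j) := by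
    intro t
    rw [sum_inner, Finset.mul_sum]
    refine Finset.sum_congr rfl fun i _ => ?_
    rw [inner_sum, Finset.mul_sum]
    refine Finset.sum_congr rfl fun j _ => ?_
    rw [inner_smul_left, inner_smul_right, ← mFourier_neg, neg_neg, sub_eq_add_neg, mFourier_add]
    ring
  have hint : ∀ i j, Integrable (fun t => (mFourier (s i - s j) t * f t) * inner ℂ (ζ i) (η j))
      (haar d) := fun i j => (integrable_continuousMap (mFourier (s i - s j) * f)).mul_const _
  -- The Toeplitz matrix is a compression of multiplication by `f`, so its form is `∫ f ⟨ζ(t), η(t)⟩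
  -- dt` with `ζ(t) = ∑ z^{-s_i} ζ_i` and likewise for `η`.
  have e2 : ∑ i, ∑ j, c (s i - s j) * inner ℂ (ζ i) (η j) =
      ∫ t, f t * inner ℂ (∑ i, mFourier (-s i) t • ζ i) (∑ j, mFourier (-s j) t • η j)
        ∂(haar d) := by
    simp only [← e1]
    rw [integral_finsetSum _ fun i _ => integrable_finsetSum _ fun j _ => hint i j]
    refine Finset.sum_congr rfl fun i _ => ?_
    rw [integral_finsetSum _ fun j _ => hint i j]
    refine Finset.sum_congr rfl fun j _ => ?_
    rw [integral_mul_const, integral_mFourier_mul_trigPoly]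
  have hsq : ∀ η : Fin n → H,
      Integrable (fun t => ‖∑ j, mFourier (-s j) t • η j‖ ^ 2) (haar d) := fun η => by
    have hc : Continuous fun t => ‖∑ j, mFourier (-s j) t • η j‖ ^ 2 := by fun_prop
    obtain ⟨M, hM⟩ := (isCompact_range hc.norm).bddAbove
    exact Integrable.of_bound hc.aestronglyMeasurable M (ae_of_all _ fun t => hM ⟨t, rfl⟩)
  rw [e2, ← integral_norm_sq_sum_mFourier hs ζ, ← integral_norm_sq_sum_mFourier hs η,
    ← integral_add (hsq ζ) (hsq η), ← integral_div, ← integral_const_mul]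
  refine norm_integral_le_of_norm_le ((((hsq ζ).add (hsq η)).div_const _).const_mul _)
    (ae_of_all _ fun t => ?_)
  rw [norm_mul]
  refine mul_le_mul (f.norm_coe_le_norm t) ((norm_inner_le_norm _ _).trans ?_) (norm_nonneg _)
    (norm_nonneg _)
  have := two_mul_le_add_sq ‖∑ i, mFourier (-s i) t • ζ i‖ ‖∑ j, mFourier (-s j) t • η j‖
  linarith


/-- The norm of the matrix `(c_{sᵢ - sⱼ} Vᵢ Vⱼ*)`, where the `Vᵢ` are unitaries. -/
theorem opNorm_matrixOperator_toeplitz_le (c : (Fin d → ℤ) →₀ ℂ) {n : ℕ} {s : Fin n → Fin d → ℤ}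
    (hs : Function.Injective s) (V : (Fin d → ℤ) → H ≃ₗᵢ[ℂ] H)
    {a : Matrix (Fin n) (Fin n) (H →L[ℂ] H)}
    (ha : ∀ i j x, a i j x = c (s i - s j) • V (s i) ((V (s j)).symm x)) :
    ‖matrixOperator a‖ ≤
      ‖(c.sum fun m a => a • mFourier (-m) : C(UnitAddTorus (Fin d), ℂ))‖ := by
  refine opNorm_le_of_norm_inner_le (norm_nonneg _) fun ξ η => ?_
  have h1 := norm_toeplitzForm_le c hs (fun i => (V (s i)).symm (η i))
    (fun j => (V (s j)).symm (ξ j))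
  simp only [LinearIsometryEquiv.norm_map] at h1
  rw [PiLp.norm_sq_eq_of_L2, PiLp.norm_sq_eq_of_L2, inner_matrixOperator]
  convert h1 using 5 with i _ j _
  rw [ha, inner_smul_right]
  congr 1
  conv_lhs => rw [← (V (s i)).apply_symm_apply (η i)]
  exact LinearIsometryEquiv.inner_map_map _ _ _

/-- Testing a completely bounded multiplier on a Toeplitz matrix. -/
theorem norm_sum_symbol_le {E : Type*} [AddCommGroup E] [Module ℂ E] [Nontrivial H]
    {ρ : E →ₗ[ℂ] H →L[ℂ] H} {T : E →ₗ[ℂ] E} {φ : (Fin d → ℤ) → ℂ}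
    {V : (Fin d → ℤ) → H ≃ₗᵢ[ℂ] H} {e : (Fin d → ℤ) → (Fin d → ℤ) → E}
    (he : ∀ s t x, ρ (e s t) x = V s ((V t).symm x)) (hT : ∀ s t, T (e s t) = φ (s - t) • e s t)
    (hN : cbNorm ρ ρ T ≠ ∞) (c : (Fin d → ℤ) →₀ ℂ) {n : ℕ} {s : Fin n → Fin d → ℤ}
    (hs : Function.Injective s) :
    ‖∑ i, ∑ j, c (s i - s j) * φ (s i - s j)‖ ≤ (cbNorm ρ ρ T).toReal *
      ‖(c.sum fun m a => a • mFourier (-m) : C(UnitAddTorus (Fin d), ℂ))‖ * n := by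
  set f := (c.sum fun m a => a • mFourier (-m) : C(UnitAddTorus (Fin d), ℂ))
  obtain ⟨v, hv⟩ := exists_norm_eq H zero_le_one
  let a : Matrix (Fin n) (Fin n) E := Matrix.of fun i j => c (s i - s j) • e (s i) (s j)
  have ha : ‖matrixOperator (a.map ρ)‖ ≤ ‖f‖ := by
    refine opNorm_matrixOperator_toeplitz_le c hs V fun i j x => ?_
    simp [a, he]
  have hTa : ‖matrixOperator ((a.map T).map ρ)‖ ≤ (cbNorm ρ ρ T).toReal * ‖f‖ := by
    -- The rescaling needs a positive bound and `‖f‖` may vanish, so a margin `ε / (N + 1)` is added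
    -- and then removed.
    refine le_of_forall_pos_le_add fun ε hε => ?_
    set N := (cbNorm ρ ρ T).toReal
    have hN0 : 0 ≤ N := ENNReal.toReal_nonneg
    have hδ : 0 < ε / (N + 1) := by positivity
    have h1 := matrixNorm_map_le_cbNorm_mul ρ ρ T a (M := ‖f‖ + ε / (N + 1))
      (by positivity) (ha.trans (by linarith))
    rw [matrixNorm, ← ofReal_norm, ← ENNReal.ofReal_toReal hN, ← ENNReal.ofReal_mul hN0,
      ENNReal.ofReal_le_ofReal_iff (by positivity)] at h1
    refine h1.trans ?_
    rw [mul_add]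
    gcongr
    rw [mul_div_assoc', div_le_iff₀ (by positivity)]
    nlinarith
  -- With these coordinates `V (s i) (V (s j))⁻¹` sends `ξ_j` to `ξ_i`, so every entry contributes
  -- exactly its scalar.
  set ξ : PiLp 2 (fun _ : Fin n => H) := WithLp.toLp 2 fun j => V (s j) v
  have hξ : ‖ξ‖ ^ 2 = n := by
    rw [PiLp.norm_sq_eq_of_L2]
    simp [ξ, hv]
  have e1 : inner ℂ ξ (matrixOperator ((a.map T).map ρ) ξ) =
      ∑ i, ∑ j, c (s i - s j) * φ (s i - s j) := by
    rw [inner_matrixOperator]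
    refine Finset.sum_congr rfl fun i _ => Finset.sum_congr rfl fun j _ => ?_
    have : (a.map T).map ρ i j (ξ j) = (c (s i - s j) * φ (s i - s j)) • V (s i) v := by
      simp [a, hT, he, ξ, smul_smul]
    rw [this, inner_smul_right]
    simp [ξ, inner_self_eq_norm_sq_to_K, hv]
  rw [← e1]
  calc _ ≤ ‖ξ‖ * ‖matrixOperator ((a.map T).map ρ) ξ‖ := norm_inner_le_norm _ _
    _ ≤ ‖ξ‖ * (((cbNorm ρ ρ T).toReal * ‖f‖) * ‖ξ‖) := by
        gcongr
        exact ContinuousLinearMap.le_of_opNorm_le _ hTa _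
    _ = _ := by rw [← hξ]; ring

end Toeplitz

/-! ### Følner averaging over boxes -/

section Folner

open Filter Topology

variable {d : ℕ}

/-- The box `{0, …, N - 1}^d`. -/
def box (d N : ℕ) : Finset (Fin d → ℤ) := Fintype.piFinset fun _ => Finset.Ico 0 (N : ℤ)

theorem card_box (d N : ℕ) : (box d N).card = N ^ d := by
  simp [box, Fintype.card_piFinset]

theorem tendsto_card_Ico_filter_div (m : ℤ) :
    Tendsto (fun N : ℕ => (((Finset.Ico 0 (N : ℤ)).filter fun k => m + k ∈ Finset.Ico 0 (N : ℤ)).card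
      : ℝ) / N) atTop (𝓝 1) := by
  have hlim : Tendsto (fun N : ℕ => 1 - (2 * |(m : ℝ)|) / (N : ℝ)) atTop (𝓝 1) := by
    simpa using (tendsto_const_div_atTop_nhds_zero_nat (2 * |(m : ℝ)|)).const_sub 1
  refine tendsto_of_tendsto_of_tendsto_of_le_of_le' hlim tendsto_const_nhds ?_ ?_
  · filter_upwards [eventually_gt_atTop 0] with N hN
    have hN' : (0 : ℝ) < N := by exact_mod_cast hN
    rw [one_sub_div hN'.ne']
    gcongr
    -- Integers at distance at least `|m|` from both ends stay in the interval when shifted by `m`,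
    -- so at most `2|m|` are lost.
    have hsub : Finset.Ico |m| ((N : ℤ) - |m|) ⊆
        (Finset.Ico 0 (N : ℤ)).filter fun k => m + k ∈ Finset.Ico 0 (N : ℤ) := by
      intro k hk
      simp only [Finset.mem_Ico, Finset.mem_filter] at hk ⊢
      have := abs_nonneg m
      have := le_abs_self m
      have := neg_abs_le m
      omega
    have h1 := Finset.card_le_card hsub
    rw [Int.card_Ico] at h1
    have h2 : (N : ℤ) - |m| - |m| ≤
        (((Finset.Ico 0 (N : ℤ)).filter fun k => m + k ∈ Finset.Ico 0 (N : ℤ)).card : ℤ) :=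
      (Int.self_le_toNat _).trans (by exact_mod_cast h1)
    have h3 : ((N : ℝ) - |(m : ℝ)| - |(m : ℝ)|) ≤
        (((Finset.Ico 0 (N : ℤ)).filter fun k => m + k ∈ Finset.Ico 0 (N : ℤ)).card : ℝ) := by
      exact_mod_cast h2
    linarith
  · filter_upwards [eventually_gt_atTop 0] with N hN
    have hN' : (0 : ℝ) < N := by exact_mod_cast hN
    rw [div_le_one hN']
    have := Finset.card_filter_le (Finset.Ico 0 (N : ℤ)) fun k => m + k ∈ Finset.Ico 0 (N : ℤ)
    rw [Int.card_Ico] at this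
    simp only [sub_zero, Int.toNat_natCast] at this
    exact_mod_cast this

theorem tendsto_card_box_filter_div (m : Fin d → ℤ) :
    Tendsto (fun N : ℕ => (((box d N).filter fun t => m + t ∈ box d N).card : ℝ) / (N : ℝ) ^ d)
      atTop (𝓝 1) := by
  have e : ∀ N : ℕ, (((box d N).filter fun t => m + t ∈ box d N).card : ℝ) / (N : ℝ) ^ d =
      ∏ i, (((Finset.Ico 0 (N : ℤ)).filter fun k => m i + k ∈ Finset.Ico 0 (N : ℤ)).card : ℝ) / N := by
    intro N
    have : (box d N).filter (fun t => m + t ∈ box d N) = Fintype.piFinset fun i =>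
        (Finset.Ico 0 (N : ℤ)).filter fun k => m i + k ∈ Finset.Ico 0 (N : ℤ) := by
      ext t
      simp only [box, Finset.mem_filter, Fintype.mem_piFinset, Pi.add_apply]
      exact forall_and.symm
    rw [this, Fintype.card_piFinset, Finset.prod_div_distrib]
    simp
  simp only [e]
  simpa using tendsto_finsetProd Finset.univ fun i _ => tendsto_card_Ico_filter_div (m i)

/-- Averages over boxes of a finitely supported function of the difference. -/
theorem tendsto_sum_box_div (S : Finset (Fin d → ℤ)) (ψ : (Fin d → ℤ) → ℂ)
    (hψ : ∀ m ∉ S, ψ m = 0) :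
    Tendsto (fun N : ℕ => (∑ s ∈ box d N, ∑ t ∈ box d N, ψ (s - t)) / (N : ℂ) ^ d) atTop
      (𝓝 (∑ m ∈ S, ψ m)) := by
  have e : ∀ N : ℕ, (∑ s ∈ box d N, ∑ t ∈ box d N, ψ (s - t)) / (N : ℂ) ^ d =
      ∑ m ∈ S, ψ m *
        ((((box d N).filter fun t => m + t ∈ box d N).card / (N : ℝ) ^ d : ℝ) : ℂ) := by
    intro N
    rw [Finset.sum_comm]
    -- Substitution `m = s - t` at fixed `t`; only `m ∈ S` can give a nonzero term.
    have h1 : ∀ t, ∑ s ∈ box d N, ψ (s - t) = ∑ m ∈ S, if m + t ∈ box d N then ψ m else 0 := by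
      intro t
      rw [← Finset.sum_filter]
      refine Finset.sum_bij_ne_zero (fun s _ _ => s - t) ?_ ?_ ?_ ?_
      · intro s hs h0
        simp only [Finset.mem_filter, sub_add_cancel]
        exact ⟨by_contra fun h => h0 (hψ _ h), hs⟩
      · intro s _ _ s' _ _ h
        exact sub_left_injective h
      · intro m hm h0
        rw [Finset.mem_filter] at hm
        exact ⟨m + t, hm.2, by simpa using h0, by simp⟩
      · intro s _ _
        rfl
    simp only [h1]
    rw [Finset.sum_comm, Finset.sum_div]
    refine Finset.sum_congr rfl fun m _ => ?_
    rw [← Finset.sum_filter, Finset.sum_const, nsmul_eq_mul]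
    push_cast
    ring
  simp only [e]
  refine tendsto_finsetSum _ fun m _ => ?_
  have := (Complex.continuous_ofReal.tendsto 1).comp (tendsto_card_box_filter_div m)
  simpa using this.const_mul (ψ m)

/-- Over a box of `N^d` points a difference `m` occurs about `N^d` times. After division by `n =
N^d` the double sum tends to `∑ c_m φ(m)`, while the right side no longer depends on `N`. -/
theorem SymbolBound.of_norm_sum_le {φ : (Fin d → ℤ) → ℂ} {C : ℝ}
    (h : ∀ (c : (Fin d → ℤ) →₀ ℂ) (n : ℕ) (s : Fin n → Fin d → ℤ), Function.Injective s →
      ‖∑ i, ∑ j, c (s i - s j) * φ (s i - s j)‖ ≤ C *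
      ‖(c.sum fun m a => a • UnitAddTorus.mFourier (-m) : C(UnitAddTorus (Fin d), ℂ))‖ * n) :
    SymbolBound φ C := by
  intro c
  set f := (c.sum fun m a => a • UnitAddTorus.mFourier (-m) : C(UnitAddTorus (Fin d), ℂ))
  have hlim := (tendsto_sum_box_div c.support (fun m => c m * φ m) fun m hm => by
    simp [Finsupp.notMem_support_iff.1 hm]).norm
  refine le_of_tendsto hlim ?_
  filter_upwards [eventually_gt_atTop 0] with N hN
  have hN' : (0 : ℝ) < (N : ℝ) ^ d := by positivity
  set n := (box d N).card
  let s : Fin n → Fin d → ℤ := fun i => ((box d N).equivFin.symm i : Fin d → ℤ)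
  have hs : Function.Injective s :=
    Subtype.val_injective.comp (box d N).equivFin.symm.injective
  have hsum : ∀ g : (Fin d → ℤ) → ℂ, ∑ i, g (s i) = ∑ t ∈ box d N, g t := fun g => by
    rw [← Finset.sum_coe_sort (box d N) g]
    exact Equiv.sum_comp (box d N).equivFin.symm fun t : box d N => g t
  have h1 := h c n s hs
  rw [hsum fun t => ∑ j, c (t - s j) * φ (t - s j)] at h1
  simp only [fun t => hsum fun t' => c (t - t') * φ (t - t')] at h1
  rw [norm_div, div_le_iff₀ (by simpa using hN')]
  refine h1.trans (le_of_eq ?_)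
  have e1 : (n : ℝ) = (N : ℝ) ^ d := by simp [n, card_box]
  have e2 : ‖(N : ℂ) ^ d‖ = (N : ℝ) ^ d := by simp
  rw [e1, e2]

/-- The symbol of a completely bounded multiplier is bounded by the completely bounded norm. -/
theorem symbolBound_of_cbNorm_ne_top {H : Type*} [NormedAddCommGroup H] [InnerProductSpace ℂ H]
    {E : Type*} [AddCommGroup E] [Module ℂ E] [Nontrivial H]
    {ρ : E →ₗ[ℂ] H →L[ℂ] H} {T : E →ₗ[ℂ] E} {φ : (Fin d → ℤ) → ℂ}
    {V : (Fin d → ℤ) → H ≃ₗᵢ[ℂ] H} {e : (Fin d → ℤ) → (Fin d → ℤ) → E}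
    (he : ∀ s t x, ρ (e s t) x = V s ((V t).symm x)) (hT : ∀ s t, T (e s t) = φ (s - t) • e s t)
    (hN : cbNorm ρ ρ T ≠ ∞) : SymbolBound φ (cbNorm ρ ρ T).toReal :=
  SymbolBound.of_norm_sum_le fun c _ _ hs => norm_sum_symbol_le he hT hN c hs

end Folner

/-! ### The torus action on `B(ℓ₂(ℤ^d))` and averages along it -/

section Averaging

open UnitAddTorus Filter Topology

variable {d : ℕ}

namespace QuantumTorus

/-- The character `z ↦ z^n` with values in the circle. -/
def circleChar (z : UnitAddTorus (Fin d)) (n : Fin d → ℤ) : Circle :=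
  ∏ i, AddCircle.toCircle (n i • z i)

theorem coe_circleChar (z : UnitAddTorus (Fin d)) (n : Fin d → ℤ) :
    (circleChar z n : ℂ) = mFourier n z := by
  have : ((circleChar z n : Circle) : ℂ) = ∏ i, (AddCircle.toCircle (n i • z i) : ℂ) :=
    map_prod Circle.coeHom _ _
  rw [this]
  simp [mFourier, fourier_apply]

theorem mFourier_neg_apply (n : Fin d → ℤ) (z : UnitAddTorus (Fin d)) :
    mFourier n (-z) = mFourier (-n) z := by
  simp [mFourier, fourier_apply]

theorem mFourier_mul_mFourier_neg (n : Fin d → ℤ) (z : UnitAddTorus (Fin d)) :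
    mFourier n z * mFourier (-n) z = 1 := by
  rw [← mFourier_add, add_neg_cancel, mFourier_zero]
  rfl

/-- The unitary `e_n ↦ z^n e_n` implementing the canonical action of `𝕋^d`. -/
def modulation (z : UnitAddTorus (Fin d)) : L2 d ≃ₗᵢ[ℂ] L2 d :=
  weighted (circleChar z) (Equiv.refl _)

theorem modulation_apply (z : UnitAddTorus (Fin d)) (x : L2 d) (n : Fin d → ℤ) :
    modulation z x n = mFourier n z * x n := by
  rw [← coe_circleChar]
  rfl

theorem modulation_symm (z : UnitAddTorus (Fin d)) (x : L2 d) :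
    (modulation z).symm x = modulation (-z) x := by
  rw [LinearIsometryEquiv.symm_apply_eq]
  ext n
  rw [modulation_apply, modulation_apply, mFourier_neg_apply, ← mul_assoc,
    mFourier_mul_mFourier_neg, one_mul]

theorem modulation_single (z : UnitAddTorus (Fin d)) (n : Fin d → ℤ) (a : ℂ) :
    modulation z (lp.single 2 n a) = mFourier n z • lp.single 2 n a := by
  ext k
  rw [modulation_apply]
  rcases eq_or_ne k n with rfl | h
  · simp
  · simp [lp.single_apply, h]

/-- On finitely supported vectors the orbit is a finite sum of characters. Since each `D_z` is
isometric, truncating `x` causes an error independent of `z`, so the limit is uniform. -/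
theorem continuous_modulation_apply (x : L2 d) :
    Continuous fun z : UnitAddTorus (Fin d) => modulation z x := by
  have hs := lp.hasSum_single (p := 2) (by simp) x
  have hF : ∀ S : Finset (Fin d → ℤ), Continuous fun z : UnitAddTorus (Fin d) =>
      modulation z (∑ n ∈ S, lp.single 2 n (x n)) := by
    intro S
    simp only [map_sum, modulation_single]
    fun_prop
  refine TendstoUniformly.continuous (p := atTop) ?_ (Frequently.of_forall hF)
  rw [Metric.tendstoUniformly_iff]
  intro ε hε
  filter_upwards [Metric.tendsto_nhds.1 hs ε hε] with S hS z
  rw [(modulation z).isometry.dist_eq, dist_comm]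
  exact hS

theorem continuous_modulation {Z : Type*} [TopologicalSpace Z] {z : Z → UnitAddTorus (Fin d)}
    {x : Z → L2 d} (hz : Continuous z) (hx : Continuous x) :
    Continuous fun t => modulation (z t) (x t) := by
  rw [continuous_iff_continuousAt]
  intro t₀
  rw [ContinuousAt, tendsto_iff_dist_tendsto_zero]
  have h1 : Tendsto (fun t => dist (x t) (x t₀) +
      dist (modulation (z t) (x t₀)) (modulation (z t₀) (x t₀))) (𝓝 t₀) (𝓝 0) := by
    have a1 := tendsto_iff_dist_tendsto_zero.1 (hx.tendsto t₀)
    have a2 := tendsto_iff_dist_tendsto_zero.1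
      (((continuous_modulation_apply (x t₀)).comp hz).tendsto t₀)
    simpa using a1.add a2
  refine squeeze_zero (fun _ => dist_nonneg) (fun t => ?_) h1
  refine (dist_triangle _ (modulation (z t) (x t₀)) _).trans ?_
  rw [(modulation (z t)).isometry.dist_eq]

/-- The orbit map of an operator under the canonical action, applied to a vector. -/
theorem continuous_orbit (X : L2 d →L[ℂ] L2 d) (ξ : L2 d) :
    Continuous fun z : UnitAddTorus (Fin d) => (modulation z).symm (X (modulation z ξ)) := by
  simp only [modulation_symm]
  exact continuous_modulation continuous_neg (X.continuous.comp (continuous_modulation_apply ξ))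

theorem norm_orbit_le (X : L2 d →L[ℂ] L2 d) (ξ : L2 d) (z : UnitAddTorus (Fin d)) :
    ‖(modulation z).symm (X (modulation z ξ))‖ ≤ ‖X‖ * ‖ξ‖ := by
  rw [LinearIsometryEquiv.norm_map]
  simpa using X.le_opNorm (modulation z ξ)

variable {ν : Measure (UnitAddTorus (Fin d))} {h : UnitAddTorus (Fin d) → ℂ}

theorem integrable_smul_orbit (hh : Integrable h ν) (X : L2 d →L[ℂ] L2 d) (ξ : L2 d) :
    Integrable (fun z => h z • (modulation z).symm (X (modulation z ξ))) ν :=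
  hh.smul_bdd (‖X‖ * ‖ξ‖) (continuous_orbit X ξ).aestronglyMeasurable
    (ae_of_all _ fun z => norm_orbit_le X ξ z)

/-- The average `∫ D_z^* X D_z h(z) dν(z)` of an operator under the canonical action. -/
def average (hh : Integrable h ν) (X : L2 d →L[ℂ] L2 d) : L2 d →L[ℂ] L2 d :=
  LinearMap.mkContinuous
    { toFun := fun ξ => ∫ z, h z • (modulation z).symm (X (modulation z ξ)) ∂ν
      map_add' := fun ξ η => by
        rw [← integral_add (integrable_smul_orbit hh X ξ) (integrable_smul_orbit hh X η)]
        simp only [map_add, smul_add]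
      map_smul' := fun c ξ => by
        rw [RingHom.id_apply, ← integral_smul]
        simp only [map_smul, smul_comm c] }
    ((∫ z, ‖h z‖ ∂ν) * ‖X‖) fun ξ => by
      rw [mul_assoc, ← integral_mul_const]
      refine norm_integral_le_of_norm_le (hh.norm.mul_const _) (ae_of_all _ fun z => ?_)
      rw [norm_smul]
      gcongr
      exact norm_orbit_le X ξ z

theorem average_apply (hh : Integrable h ν) (X : L2 d →L[ℂ] L2 d) (ξ : L2 d) :
    average hh X ξ = ∫ z, h z • (modulation z).symm (X (modulation z ξ)) ∂ν := rfl

theorem integrable_inner_orbit (hh : Integrable h ν) (X : L2 d →L[ℂ] L2 d) (ξ η : L2 d) :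
    Integrable (fun z => h z * inner ℂ (modulation z η) (X (modulation z ξ))) ν := by
  refine ((integrable_smul_orbit hh X ξ).const_inner (𝕜 := ℂ) η).congr (ae_of_all _ fun z => ?_)
  simp only [inner_smul_right]
  rw [← (modulation z).inner_map_map η, LinearIsometryEquiv.apply_symm_apply]

theorem inner_average (hh : Integrable h ν) (X : L2 d →L[ℂ] L2 d) (ξ η : L2 d) :
    inner ℂ η (average hh X ξ) =
      ∫ z, h z * inner ℂ (modulation z η) (X (modulation z ξ)) ∂ν := by
  rw [average_apply, ← integral_inner (integrable_smul_orbit hh X ξ)]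
  refine integral_congr_ae (ae_of_all _ fun z => ?_)
  simp only [inner_smul_right]
  rw [← (modulation z).inner_map_map η, LinearIsometryEquiv.apply_symm_apply]

/-- The matrix coefficients of an averaged operator. -/
theorem average_single_apply (hh : Integrable h ν) (X : L2 d →L[ℂ] L2 d) (j k : Fin d → ℤ) :
    average hh X (lp.single 2 k 1) j =
      ClassicalTorus.fourierTransform (ν.withDensityᵥ h) (j - k) * X (lp.single 2 k 1) j := by
  have e : ∀ v : L2 d, v j = inner ℂ (lp.single 2 j (1 : ℂ) : L2 d) v := fun v => by
    rw [lp.inner_single_left]; simp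
  rw [e, inner_average, fourierTransform_withDensityᵥ hh, ← integral_mul_const]
  refine integral_congr_ae (ae_of_all _ fun z => ?_)
  simp only [modulation_single, map_smul, inner_smul_left, inner_smul_right, ← e]
  rw [← mFourier_neg, neg_sub, sub_eq_add_neg, mFourier_add]
  ring

theorem average_add (hh : Integrable h ν) (X Y : L2 d →L[ℂ] L2 d) :
    average hh (X + Y) = average hh X + average hh Y := by
  ext1 ξ
  simp only [_root_.add_apply, average_apply, map_add, smul_add]
  exact integral_add (integrable_smul_orbit hh X ξ) (integrable_smul_orbit hh Y ξ)

theorem average_smul (hh : Integrable h ν) (c : ℂ) (X : L2 d →L[ℂ] L2 d) :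
    average hh (c • X) = c • average hh X := by
  ext1 ξ
  simp only [_root_.smul_apply, average_apply, map_smul, smul_comm _ c]
  exact integral_smul _ _

theorem ext_of_single {A B : L2 d →L[ℂ] L2 d}
    (hAB : ∀ n, A (lp.single 2 n 1) = B (lp.single 2 n 1)) : A = B := by
  refine lp.ext_continuousLinearMap (by simp) fun n => ?_
  ext1
  exact hAB n

end QuantumTorus

end Averaging

/-! ### Multipliers of the quantum torus from measures -/

section QuantumMultipliers

open UnitAddTorus

namespace QuantumTorus

variable {d : ℕ} (θ : Matrix (Fin d) (Fin d) ℝ)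

theorem star_toOp (V : L2 d ≃ₗᵢ[ℂ] L2 d) : star (toOp V) = toOp V.symm :=
  V.star_eq_symm

/-- The generators are unitary, so an operator commuting with them also commutes with their
adjoints; the adjoint conditions in the double commutant are therefore redundant. -/
theorem mem_algebra_iff {x : L2 d →L[ℂ] L2 d} :
    x ∈ (algebra θ).toSubalgebra ↔ ∀ y : L2 d →L[ℂ] L2 d,
      (∀ j v, y (gen θ j v) = gen θ j (y v)) → ∀ v, y (x v) = x (y v) := by
  have hc : ∀ y : L2 d →L[ℂ] L2 d,
      y ∈ StarSubalgebra.centralizer ℂ (Set.range fun j => toOp (gen θ j)) ↔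
      ∀ j v, y (gen θ j v) = gen θ j (y v) := by
    intro y
    rw [StarSubalgebra.mem_centralizer_iff]
    constructor
    · intro hy j v
      exact (congrArg (fun A => A v) (hy _ ⟨j, rfl⟩).1).symm
    · rintro hy _ ⟨j, rfl⟩
      refine ⟨ContinuousLinearMap.ext fun v => (hy j v).symm, ContinuousLinearMap.ext fun v => ?_⟩
      rw [star_toOp]
      change (gen θ j).symm (y v) = y ((gen θ j).symm v)
      rw [LinearIsometryEquiv.symm_apply_eq, ← hy, LinearIsometryEquiv.apply_symm_apply]
  have hm : x ∈ (algebra θ).toSubalgebra ↔ x ∈ StarSubalgebra.centralizer ℂ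
      (StarSubalgebra.centralizer ℂ (Set.range fun j => toOp (gen θ j)) :
        Set (L2 d →L[ℂ] L2 d)) := Iff.rfl
  rw [hm, StarSubalgebra.mem_centralizer_iff]
  constructor
  · intro hx y hy v
    exact congrArg (fun A => A v) (hx y ((hc y).2 hy)).1
  · intro hx y hy
    exact ⟨ContinuousLinearMap.ext (hx y ((hc y).1 hy)),
      ContinuousLinearMap.ext (hx _ ((hc _).1 (star_mem hy)))⟩

theorem modulation_gen (z : UnitAddTorus (Fin d)) (j : Fin d) (v : L2 d) :
    modulation z (gen θ j v) = mFourier (Pi.single j 1) z • gen θ j (modulation z v) := by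
  ext n
  rw [modulation_apply, gen_apply, lp.coeFn_smul, Pi.smul_apply, gen_apply, modulation_apply]
  have : mFourier n z = mFourier (Pi.single j 1) z * mFourier (n - Pi.single j 1) z := by
    rw [← mFourier_add, add_sub_cancel]
  rw [this, smul_eq_mul]
  ring

/-- Conjugation by `D_z` only rescales each generator by a unimodular number, so it maps the
commutant into itself. -/
theorem conj_modulation_gen {y : L2 d →L[ℂ] L2 d} (hy : ∀ j v, y (gen θ j v) = gen θ j (y v))
    (z : UnitAddTorus (Fin d)) (j : Fin d) (v : L2 d) :
    modulation z (y ((modulation z).symm (gen θ j v))) =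
      gen θ j (modulation z (y ((modulation z).symm v))) := by
  have h1 : (modulation z).symm (gen θ j v) =
      mFourier (-Pi.single j 1) z • gen θ j ((modulation z).symm v) := by
    rw [modulation_symm, modulation_gen, mFourier_neg_apply, modulation_symm]
  rw [h1, map_smul, map_smul, hy, modulation_gen, smul_smul, mul_comm, mFourier_mul_mFourier_neg,
    one_smul]

variable {ν : Measure (UnitAddTorus (Fin d))} {h : UnitAddTorus (Fin d) → ℂ}

/-- Averages of elements of the quantum torus belong to the quantum torus. -/
theorem average_mem (hh : Integrable h ν) {x : L2 d →L[ℂ] L2 d}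
    (hx : x ∈ (algebra θ).toSubalgebra) : average hh x ∈ (algebra θ).toSubalgebra := by
  rw [mem_algebra_iff] at hx ⊢
  intro y hy v
  rw [average_apply, average_apply,
    ← ContinuousLinearMap.integral_comp_comm y (integrable_smul_orbit hh x v)]
  refine integral_congr_ae (ae_of_all _ fun z => ?_)
  simp only [map_smul]
  congr 1
  -- This conjugate of `y` lies in the commutant again, so `x` commutes with it; undoing the
  -- conjugation shows that `D_z^* x D_z` commutes with `y`.
  let y' : L2 d →L[ℂ] L2 d := toOp (modulation z) * y * toOp (modulation z).symm
  have h1 := hx y' (fun j v => conj_modulation_gen θ hy z j v) (modulation z v)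
  change modulation z (y ((modulation z).symm (x (modulation z v)))) =
    x (modulation z (y ((modulation z).symm (modulation z v)))) at h1
  rw [LinearIsometryEquiv.symm_apply_apply] at h1
  rw [← h1, LinearIsometryEquiv.symm_apply_apply]

/-- The multiplier of the quantum torus with the Fourier transform of a measure as its symbol. -/
def averageMap (hh : Integrable h ν) :
    (algebra θ).toSubalgebra →ₗ[ℂ] (algebra θ).toSubalgebra where
  toFun x := ⟨average hh x, average_mem θ hh x.2⟩
  map_add' x y := Subtype.ext (average_add hh x y)
  map_smul' c x := Subtype.ext (average_smul hh c x)

/-- As `U^m` sends `U^0` to the basis vector `e_m`, the Fourier coefficients of an operator are the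
entries of its column of index `0`. -/
theorem coeff_eq (x : L2 d →L[ℂ] L2 d) (m : Fin d → ℤ) : coeff θ x m = x (vac d) m := by
  rw [coeff, trace, star_toOp]
  change inner ℂ (vac d) ((monomial θ m).symm (x (vac d))) = _
  rw [← (monomial θ m).inner_map_map, LinearIsometryEquiv.apply_symm_apply, monomial_vac,
    lp.inner_single_left]
  simp

theorem isMultiplierMap_averageMap (hh : Integrable h ν) :
    IsMultiplierMap θ (ClassicalTorus.fourierTransform (ν.withDensityᵥ h)) (averageMap θ hh) := by
  intro x m
  rw [coeff_eq, coeff_eq]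
  have := average_single_apply hh (incl θ x) m 0
  rw [sub_zero] at this
  exact this

theorem cbNorm_averageMap_le (hh : Integrable h ν) :
    cbNorm (incl θ) (incl θ) (averageMap θ hh) ≤ ENNReal.ofReal (∫ z, ‖h z‖ ∂ν) :=
  cbNorm_le_of_inner_eq_integral hh modulation (incl θ) (averageMap θ hh)
    (fun x ξ η => integrable_inner_orbit hh (incl θ x) ξ η)
    fun x ξ η => inner_average hh (incl θ x) ξ η

theorem exists_multiplier_of_measure (μ : ComplexMeasure (UnitAddTorus (Fin d))) :
    ∃ T, IsMultiplierMap θ (ClassicalTorus.fourierTransform μ) T ∧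
      cbNorm (incl θ) (incl θ) T ≤ μ.variation Set.univ := by
  obtain ⟨ν, h, hν, hh, rfl⟩ := μ.exists_eq_withDensityᵥ
  refine ⟨averageMap θ hh, isMultiplierMap_averageMap θ hh, (cbNorm_averageMap_le θ hh).trans ?_⟩
  rw [Measure.variation_withDensityᵥ hh, withDensity_apply _ MeasurableSet.univ,
    Measure.restrict_univ, ← ofReal_integral_norm_eq_lintegral_enorm hh]

end QuantumTorus

end QuantumMultipliers

/-! ### Symbols of completely bounded multipliers of the quantum torus -/

section QuantumSymbols

namespace QuantumTorus

variable {d : ℕ} (θ : Matrix (Fin d) (Fin d) ℝ)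

/-- The phase with `U^n U_k = rightPhase θ k n • U^{n + e_k}`. -/
def rightPhase (k : Fin d) (n : Fin d → ℤ) : Circle :=
  Circle.exp (2 * Real.pi * ∑ j ∈ Finset.univ.filter (k < ·), θ j k * n j)

/-- Right multiplication by `U_k` on `L₂(𝕋^d_θ)`. -/
def rightGen (k : Fin d) : L2 d ≃ₗᵢ[ℂ] L2 d :=
  weighted (fun n => rightPhase θ k (n - Pi.single k 1)) (Equiv.subRight (Pi.single k 1))

theorem rightGen_apply (k : Fin d) (x : L2 d) (n : Fin d → ℤ) :
    rightGen θ k x n = rightPhase θ k (n - Pi.single k 1) * x (n - Pi.single k 1) := rfl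

theorem phase_add_single (j k : Fin d) (v : Fin d → ℤ) :
    phase θ j (v + Pi.single k 1) =
      phase θ j v * Circle.exp (if k < j then 2 * Real.pi * θ j k else 0) := by
  rw [phase, phase, ← Circle.exp_add]
  congr 1
  simp [mul_add, Finset.sum_add_distrib, Pi.single_apply, Finset.sum_filter]

theorem rightPhase_add_single (j k : Fin d) (v : Fin d → ℤ) :
    rightPhase θ k (v + Pi.single j 1) =
      rightPhase θ k v * Circle.exp (if k < j then 2 * Real.pi * θ j k else 0) := by
  rw [rightPhase, rightPhase, ← Circle.exp_add]
  congr 1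
  simp [mul_add, Finset.sum_add_distrib, Pi.single_apply, Finset.sum_filter]

/-- Left and right multiplications commute: passing `e_k` through the left phase and `e_j` through
the right phase costs the same factor `e^{2πi θ_{jk}}`, present only when `k < j`. -/
theorem rightGen_gen (j k : Fin d) (x : L2 d) :
    rightGen θ k (gen θ j x) = gen θ j (rightGen θ k x) := by
  ext n
  rw [rightGen_apply, gen_apply, gen_apply, rightGen_apply]
  set v := n - Pi.single k 1 - Pi.single j 1 with hv
  have h1 : n - Pi.single k 1 = v + Pi.single j 1 := by rw [hv, sub_add_cancel]
  have h2 : n - Pi.single j 1 = v + Pi.single k 1 := by rw [hv]; abel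
  rw [h2, add_sub_cancel_right, h1, phase_add_single, rightPhase_add_single]
  push_cast
  ring

theorem rightGen_single (k : Fin d) (n : Fin d → ℤ) :
    rightGen θ k (lp.single 2 n 1) =
      (rightPhase θ k n : ℂ) • lp.single 2 (n + Pi.single k 1) 1 := by
  ext m
  rw [rightGen_apply]
  by_cases h : m = n + Pi.single k 1
  · subst h; simp
  · have h' : m - Pi.single k 1 ≠ n := fun h0 => h (by rw [← h0]; abel)
    simp [lp.single_apply, h, h']

/-- The vacuum vector is separating for the quantum torus. -/
theorem eq_zero_of_apply_vac_eq_zero {x : L2 d →L[ℂ] L2 d} (hx : x ∈ (algebra θ).toSubalgebra)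
    (h0 : x (vac d) = 0) : x = 0 := by
  rw [mem_algebra_iff] at hx
  have hR : ∀ k v, rightGen θ k (x v) = x (rightGen θ k v) := fun k v =>
    hx (toOp (rightGen θ k)) (fun j v => rightGen_gen θ j k v) v
  -- Translations that preserve the set of `n` with `x e_n = 0`. Each `e_k` is one, because `x`
  -- commutes with `R_k` and `R_k e_n` is a unimodular multiple of `e_{n + e_k}`.
  let A : AddSubgroup (Fin d → ℤ) :=
    { carrier := {m | ∀ n, x (lp.single 2 n 1) = 0 ↔ x (lp.single 2 (n + m) 1) = 0}
      add_mem' := fun {a b} ha hb n => by rw [ha n, hb (n + a), add_assoc]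
      zero_mem' := fun n => by rw [add_zero]
      neg_mem' := fun {a} ha n => by rw [ha (n + -a), neg_add_cancel_right] }
  have hgen : ∀ k, (Pi.single k 1 : Fin d → ℤ) ∈ A := fun k n => by
    have h1 := hR k (lp.single 2 n 1)
    rw [rightGen_single, map_smul] at h1
    rw [← (rightGen θ k).map_eq_zero_iff, h1, smul_eq_zero]
    simp
  have hall : ∀ m, m ∈ A := fun m => by
    rw [← Finset.univ_sum_single m]
    refine sum_mem fun k _ => ?_
    have : (Pi.single k (m k) : Fin d → ℤ) = m k • Pi.single k 1 := by
      rw [← Pi.single_smul]; simp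
    rw [this]
    exact zsmul_mem (hgen k) _
  refine ext_of_single fun n => ?_
  have := (hall n 0).1 h0
  rw [zero_add] at this
  exact this

theorem eq_of_coeff_eq {x y : (algebra θ).toSubalgebra}
    (h : ∀ m, coeff θ (incl θ x) m = coeff θ (incl θ y) m) : x = y := by
  have h1 : incl θ (x - y) = 0 := by
    refine eq_zero_of_apply_vac_eq_zero θ (x - y).2 ?_
    ext m
    have := h m
    rw [coeff_eq, coeff_eq] at this
    rw [map_sub]
    exact sub_eq_zero.2 this
  exact sub_eq_zero.1 (Subtype.ext h1)

/-- The operator `V` is a weighted shift by `s`. -/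
def IsShift (V : L2 d ≃ₗᵢ[ℂ] L2 d) (s : Fin d → ℤ) : Prop :=
  ∃ c : (Fin d → ℤ) → ℂ, (∀ n, c n ≠ 0) ∧ ∀ x n, V x n = c n * x (n - s)

theorem IsShift.mul {V W : L2 d ≃ₗᵢ[ℂ] L2 d} {s t : Fin d → ℤ} (hV : IsShift V s)
    (hW : IsShift W t) : IsShift (V * W) (s + t) := by
  obtain ⟨c, hc, hV⟩ := hV
  obtain ⟨c', hc', hW⟩ := hW
  refine ⟨fun n => c n * c' (n - s), fun n => mul_ne_zero (hc _) (hc' _), fun x n => ?_⟩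
  change V (W x) n = _
  rw [hV, hW, mul_assoc, sub_sub]

theorem IsShift.one : IsShift (1 : L2 d ≃ₗᵢ[ℂ] L2 d) 0 :=
  ⟨fun _ => 1, fun _ => one_ne_zero, fun x n => by simp⟩

theorem IsShift.inv {V : L2 d ≃ₗᵢ[ℂ] L2 d} {s : Fin d → ℤ} (hV : IsShift V s) :
    IsShift V⁻¹ (-s) := by
  obtain ⟨c, hc, hV⟩ := hV
  refine ⟨fun n => (c (n + s))⁻¹, fun n => inv_ne_zero (hc _), fun x n => ?_⟩
  have h1 := hV (V⁻¹ x) (n + s)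
  have h2 : V (V⁻¹ x) = x := V.apply_symm_apply x
  rw [h2, add_sub_cancel_right] at h1
  rw [sub_neg_eq_add, h1, inv_mul_cancel_left₀ (hc _)]

theorem isShift_gen (j : Fin d) : IsShift (gen θ j) (Pi.single j 1) :=
  ⟨fun n => phase θ j (n - Pi.single j 1), fun _ => Circle.coe_ne_zero _, fun x n => gen_apply θ j x n⟩

theorem isShift_gen_zpow (j : Fin d) (z : ℤ) : IsShift (gen θ j ^ z) (Pi.single j z) := by
  induction z using Int.induction_on with
  | zero => simpa using IsShift.one
  | succ i ih =>
    rw [zpow_add_one, Pi.single_add]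
    exact ih.mul (isShift_gen θ j)
  | pred i ih =>
    rw [zpow_sub_one, Pi.single_sub, sub_eq_add_neg]
    exact ih.mul (isShift_gen θ j).inv

theorem isShift_monomial (m : Fin d → ℤ) : IsShift (monomial θ m) m := by
  have key : ∀ l : List (Fin d), IsShift (l.map fun k => gen θ k ^ m k).prod
      ((l.map fun k => Pi.single k (m k)).sum : Fin d → ℤ) := by
    intro l
    induction l with
    | nil => exact IsShift.one
    | cons a l ih =>
      rw [List.map_cons, List.prod_cons, List.map_cons, List.sum_cons]
      exact (isShift_gen_zpow θ a _).mul ih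
  have h := key (List.finRange d)
  rwa [← List.ofFn_eq_map, ← List.ofFn_eq_map, List.sum_ofFn, Finset.univ_sum_single] at h

theorem monomial_mem_of_commute {y : L2 d →L[ℂ] L2 d}
    (hy : ∀ j v, y (gen θ j v) = gen θ j (y v)) (m : Fin d → ℤ) (v : L2 d) :
    y (monomial θ m v) = monomial θ m (y v) := by
  let G : Subgroup (L2 d ≃ₗᵢ[ℂ] L2 d) :=
    { carrier := {V | ∀ v, y (V v) = V (y v)}
      mul_mem' := fun {V W} hV hW v => by
        change y (V (W v)) = V (W (y v))
        rw [hV, hW]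
      one_mem' := fun v => rfl
      inv_mem' := fun {V} hV v => by
        change y (V.symm v) = V.symm (y v)
        rw [LinearIsometryEquiv.eq_symm_apply, ← hV, LinearIsometryEquiv.apply_symm_apply] }
  have : monomial θ m ∈ G := by
    refine Subgroup.list_prod_mem G fun V hV => ?_
    obtain ⟨k, rfl⟩ := (List.mem_ofFn' _ _).1 hV
    exact zpow_mem (show gen θ k ∈ G from hy k) _
  exact this v

/-- The element `U^s (U^t)^*` of the quantum torus. -/
def monomialRatio (s t : Fin d → ℤ) : (algebra θ).toSubalgebra :=
  ⟨toOp (monomial θ s * (monomial θ t)⁻¹), (mem_algebra_iff θ).2 fun y hy v => by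
    change y (monomial θ s ((monomial θ t).symm v)) = monomial θ s ((monomial θ t).symm (y v))
    rw [monomial_mem_of_commute θ hy]
    congr 1
    rw [LinearIsometryEquiv.eq_symm_apply, ← monomial_mem_of_commute θ hy,
      LinearIsometryEquiv.apply_symm_apply]⟩

/-- `U^s (U^t)^*` moves `U^0` to a multiple of `e_{s-t}`, so it has a single Fourier coefficient and
is an eigenvector of `T`. The phase depending on `θ` never has to be computed. -/
theorem IsMultiplierMap.map_monomialRatio {φ : (Fin d → ℤ) → ℂ}
    {T : (algebra θ).toSubalgebra →ₗ[ℂ] (algebra θ).toSubalgebra} (hT : IsMultiplierMap θ φ T)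
    (s t : Fin d → ℤ) : T (monomialRatio θ s t) = φ (s - t) • monomialRatio θ s t := by
  refine eq_of_coeff_eq θ fun m => ?_
  rw [hT, map_smul, coeff_eq, coeff_eq]
  change φ m * (monomial θ s * (monomial θ t)⁻¹) (vac d) m =
    φ (s - t) * (monomial θ s * (monomial θ t)⁻¹) (vac d) m
  obtain ⟨c, -, hc⟩ := (isShift_monomial θ s).mul (isShift_monomial θ t).inv
  rw [← sub_eq_add_neg] at hc
  rcases eq_or_ne m (s - t) with rfl | hm
  · rfl
  · have : (vac d : L2 d) (m - (s - t)) = 0 := by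
      simp [vac, lp.single_apply, sub_eq_zero, hm]
    rw [hc, this, mul_zero, mul_zero, mul_zero]

instance : Nontrivial (L2 d) :=
  ⟨⟨vac d, 0, fun h => by simpa [vac] using congrArg (fun v : L2 d => v 0) h⟩⟩

theorem symbolBound_of_isMultiplierMap {φ : (Fin d → ℤ) → ℂ}
    {T : (algebra θ).toSubalgebra →ₗ[ℂ] (algebra θ).toSubalgebra} (hT : IsMultiplierMap θ φ T)
    (hN : cbNorm (incl θ) (incl θ) T ≠ ∞) :
    SymbolBound φ (cbNorm (incl θ) (incl θ) T).toReal :=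
  symbolBound_of_cbNorm_ne_top (V := monomial θ) (e := monomialRatio θ) (fun _ _ _ => rfl)
    hT.map_monomialRatio hN

end QuantumTorus

end QuantumSymbols

/-! ### Multipliers of `L_∞(𝕋^d)` -/

section ClassicalMultipliers

open UnitAddTorus

namespace ClassicalTorus

variable {d : ℕ}

/-- The Fourier transform `L₂(𝕋^d) → ℓ₂(ℤ^d)`. -/
def fourierIso (d : ℕ) : L2 d ≃ₗᵢ[ℂ] QuantumTorus.L2 d :=
  (mFourierBasis (d := Fin d)).repr

theorem fourierIso_apply (f : L2 d) (m : Fin d → ℤ) : fourierIso d f m = coeff f m :=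
  mFourierBasis_repr f m

theorem coeff_congr {f g : UnitAddTorus (Fin d) → ℂ} (hfg : f =ᵐ[haar d] g) (m : Fin d → ℤ) :
    coeff f m = coeff g m :=
  integral_congr_ae (hfg.mono fun t ht => by simp only [ht])

theorem coeff_mFourier_mul (f : UnitAddTorus (Fin d) → ℂ) (k m : Fin d → ℤ) :
    coeff (fun t => mFourier k t * f t) m = coeff f (m - k) := by
  refine integral_congr_ae (ae_of_all _ fun t => ?_)
  simp only
  rw [← mul_assoc, ← mFourier_add, neg_sub, sub_eq_add_neg, add_comm k]

theorem mFourier_apply_add (n : Fin d → ℤ) (s t : UnitAddTorus (Fin d)) :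
    mFourier n (s + t) = mFourier n s * mFourier n t := by
  simp [mFourier, fourier_apply, smul_add, AddCircle.toCircle_add, Finset.prod_mul_distrib]

theorem integrable_linf (f : Linf d) : Integrable f (haar d) :=
  (Lp.memLp f).integrable le_top

theorem integrable_mFourier_mul (f : Linf d) (m : Fin d → ℤ) :
    Integrable (fun t => mFourier m t * f t) (haar d) :=
  (integrable_linf f).bdd_mul (mFourier m).continuous.aestronglyMeasurable
    (ae_of_all _ (mFourier m).norm_coe_le_norm)

theorem coeff_add (f g : Linf d) (m : Fin d → ℤ) :
    coeff (f + g : Linf d) m = coeff f m + coeff g m := by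
  rw [coeff_congr (Lp.coeFn_add f g), coeff, coeff, coeff,
    ← integral_add (integrable_mFourier_mul f _) (integrable_mFourier_mul g _)]
  simp only [Pi.add_apply, mul_add]

theorem coeff_smul (c : ℂ) (f : Linf d) (m : Fin d → ℤ) :
    coeff (c • f : Linf d) m = c * coeff f m := by
  rw [coeff_congr (Lp.coeFn_smul c f), coeff, coeff, ← integral_const_mul]
  simp only [Pi.smul_apply, smul_eq_mul, mul_left_comm]

/-- Bounded functions lie in `L₂`, where the Fourier transform is injective. -/
theorem linf_ext {f g : Linf d} (h : ∀ m, coeff f m = coeff g m) : f = g := by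
  have hf := (Lp.memLp f).mono_exponent (p := 2) le_top
  have hg := (Lp.memLp g).mono_exponent (p := 2) le_top
  have h1 : hf.toLp f = hg.toLp g := by
    apply (fourierIso d).injective
    ext m
    rw [fourierIso_apply, fourierIso_apply, coeff_congr hf.coeFn_toLp, coeff_congr hg.coeFn_toLp, h]
  exact Lp.ext ((MemLp.toLp_eq_toLp_iff hf hg).1 h1)

/-- A continuous function as an element of `L_∞(𝕋^d)`. -/
def ofContinuous (f : C(UnitAddTorus (Fin d), ℂ)) : Linf d := ContinuousMap.toLp ∞ (haar d) ℂ f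

theorem coeFn_ofContinuous (f : C(UnitAddTorus (Fin d), ℂ)) : ofContinuous f =ᵐ[haar d] f :=
  ContinuousMap.coeFn_toLp (𝕜 := ℂ) _ f

theorem coeff_mFourier (k m : Fin d → ℤ) : coeff (mFourier k) m = if m = k then 1 else 0 := by
  rw [coeff]
  simp only [← mFourier_add]
  rw [integral_mFourier]
  simp only [neg_add_eq_zero]

theorem ae_norm_le (f : Linf d) : ∀ᵐ t ∂(haar d), ‖f t‖ ≤ ‖f‖ := by
  have h1 := ae_le_eLpNormEssSup (f := f) (μ := haar d)
  rw [← eLpNorm_exponent_top] at h1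
  filter_upwards [h1] with t ht
  rw [Lp.norm_def]
  exact (toReal_enorm _).symm.trans_le (ENNReal.toReal_mono (Lp.eLpNorm_ne_top f) ht)

theorem norm_le_of_ae_le {f : Linf d} {C : ℝ} (hC : 0 ≤ C) (h : ∀ᵐ t ∂(haar d), ‖f t‖ ≤ C) :
    ‖f‖ ≤ C := by
  simpa using Lp.norm_le_of_ae_bound hC h

/-- Nonempty open sets have positive Haar measure, so the essential supremum of a continuous
function bounds each of its values. -/
theorem norm_apply_le_norm_ofContinuous (f : C(UnitAddTorus (Fin d), ℂ)) (t : UnitAddTorus (Fin d)) :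
    ‖f t‖ ≤ ‖ofContinuous f‖ := by
  by_contra! hlt
  have hopen : IsOpen {t | ‖ofContinuous f‖ < ‖f t‖} := isOpen_lt continuous_const (by fun_prop)
  refine (hopen.measure_pos (haar d) ⟨t, hlt⟩).ne' ?_
  rw [← compl_compl {t | ‖ofContinuous f‖ < ‖f t‖}]
  refine mem_ae_iff.1 ?_
  filter_upwards [ae_norm_le (ofContinuous f), coeFn_ofContinuous f] with t h1 h2
  simpa [← h2] using h1

theorem norm_ofContinuous_le (f : C(UnitAddTorus (Fin d), ℂ)) : ‖ofContinuous f‖ ≤ ‖f‖ := by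
  refine norm_le_of_ae_le (norm_nonneg _) ?_
  filter_upwards [coeFn_ofContinuous f] with t ht
  rw [ht]
  exact f.norm_coe_le_norm t

theorem IsMultiplierMap.map_mFourier {φ : (Fin d → ℤ) → ℂ} {T : Linf d →ₗ[ℂ] Linf d}
    (hT : IsMultiplierMap φ T) (k : Fin d → ℤ) :
    T (ofContinuous (mFourier k)) = φ k • ofContinuous (mFourier k) := by
  refine linf_ext fun m => ?_
  rw [hT, coeff_smul, coeff_congr (coeFn_ofContinuous _), coeff_mFourier]
  split_ifs with h
  · rw [h]
  · simp

/-- The reflection `t ↦ -t` reconciles the characters `z^m` on which a multiplier acts with the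
`z^{-m}` in `SymbolBound`. -/
theorem norm_trigPoly_le_norm_neg (c : (Fin d → ℤ) →₀ ℂ) :
    ‖(c.sum fun m a => a • mFourier m : C(UnitAddTorus (Fin d), ℂ))‖ ≤
      ‖(c.sum fun m a => a • mFourier (-m) : C(UnitAddTorus (Fin d), ℂ))‖ := by
  refine (ContinuousMap.norm_le _ (norm_nonneg _)).2 fun t => ?_
  have h := ContinuousMap.norm_coe_le_norm
    (c.sum fun m a => a • mFourier (-m) : C(UnitAddTorus (Fin d), ℂ)) (-t)
  convert h using 2
  simp [Finsupp.sum, ContinuousMap.coe_sum, QuantumTorus.mFourier_neg_apply]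

/-- The symbol of a bounded multiplier is bounded by the norm of the multiplier. -/
theorem symbolBound_of_isMultiplierMap {φ : (Fin d → ℤ) → ℂ} {T : Linf d →L[ℂ] Linf d}
    (hT : IsMultiplierMap φ (T : Linf d →ₗ[ℂ] Linf d)) : SymbolBound φ ‖T‖ := by
  intro c
  set F := (c.sum fun m a => a • mFourier m : C(UnitAddTorus (Fin d), ℂ))
  set G := (c.sum fun m a => (a * φ m) • mFourier m : C(UnitAddTorus (Fin d), ℂ))
  have hTF : T (ofContinuous F) = ofContinuous G := by
    simp only [F, G, Finsupp.sum, ofContinuous, map_sum, map_smul, mul_smul]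
    refine Finset.sum_congr rfl fun m _ => ?_
    congr 1
    exact hT.map_mFourier m
  -- Every character equals `1` at the origin.
  have hG : c.sum (fun m a => a * φ m) = G 0 := by
    simp [G, Finsupp.sum, ContinuousMap.coe_sum, mFourier]
  calc ‖c.sum fun m a => a * φ m‖ = ‖G 0‖ := by rw [hG]
    _ ≤ ‖ofContinuous G‖ := norm_apply_le_norm_ofContinuous G 0
    _ ≤ ‖T‖ * ‖ofContinuous F‖ := by rw [← hTF]; exact T.le_opNorm _
    _ ≤ _ := by
        gcongr
        exact (norm_ofContinuous_le F).trans (norm_trigPoly_le_norm_neg c)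

theorem coeFn_mulRep (f : Linf d) (ξ : L2 d) : mulRep d f ξ =ᵐ[haar d] fun t => f t * ξ t :=
  (ContinuousLinearMap.mul ℂ ℂ).coeFn_holder f ξ

/-- The unitary of `L₂(𝕋^d)` of multiplication by `z^s`. -/
def charMul (s : Fin d → ℤ) : L2 d ≃ₗᵢ[ℂ] L2 d :=
  (fourierIso d).trans
    ((QuantumTorus.weighted (fun _ => 1) (Equiv.subRight s)).trans (fourierIso d).symm)

theorem fourierIso_charMul (s : Fin d → ℤ) (ξ : L2 d) (n : Fin d → ℤ) :
    fourierIso d (charMul s ξ) n = fourierIso d ξ (n - s) := by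
  simp only [charMul, LinearIsometryEquiv.trans_apply, LinearIsometryEquiv.apply_symm_apply]
  exact one_mul _

theorem mulRep_mFourier (s t : Fin d → ℤ) (ξ : L2 d) :
    mulRep d (ofContinuous (mFourier (s - t))) ξ = charMul s ((charMul t).symm ξ) := by
  apply (fourierIso d).injective
  ext n
  have h1 : mulRep d (ofContinuous (mFourier (s - t))) ξ =ᵐ[haar d]
      fun x => mFourier (s - t) x * ξ x := by
    filter_upwards [coeFn_mulRep (ofContinuous (mFourier (s - t))) ξ,
      coeFn_ofContinuous (mFourier (s - t))] with x h1 h2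
    rw [h1, h2]
  have h2 := fourierIso_charMul t ((charMul t).symm ξ) (n - s + t)
  rw [LinearIsometryEquiv.apply_symm_apply, add_sub_cancel_right] at h2
  rw [fourierIso_charMul, ← h2, fourierIso_apply, fourierIso_apply, coeff_congr h1,
    coeff_mFourier_mul, sub_sub_eq_add_sub, sub_add_eq_add_sub]

instance : Nontrivial (L2 d) := (fourierIso d).toEquiv.nontrivial

theorem symbolBound_of_cbNorm {φ : (Fin d → ℤ) → ℂ} {T : Linf d →ₗ[ℂ] Linf d}
    (hT : IsMultiplierMap φ T) (hN : cbNorm (mulRep d) (mulRep d) T ≠ ∞) :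
    SymbolBound φ (cbNorm (mulRep d) (mulRep d) T).toReal :=
  symbolBound_of_cbNorm_ne_top (V := charMul) (e := fun s t => ofContinuous (mFourier (s - t)))
    mulRep_mFourier (fun s t => hT.map_mFourier (s - t)) hN

variable {ν : Measure (UnitAddTorus (Fin d))} {h : UnitAddTorus (Fin d) → ℂ}

/-- Convolution of a bounded function with a measure. -/
theorem exists_convolution [IsFiniteMeasure ν] (hh : Integrable h ν) (f : Linf d) :
    ∃ g : Linf d, (∀ m, coeff g m = fourierTransform (ν.withDensityᵥ h) m * coeff f m) ∧
      ‖g‖ ≤ (∫ s, ‖h s‖ ∂ν) * ‖f‖ := by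
  -- A representative bounded everywhere: `ν` may be singular, so an almost everywhere bound for
  -- Haar measure does not control `∫ f(t - s) h(s) dν(s)` at every `t`.
  set f₁ : UnitAddTorus (Fin d) → ℂ := {t | ‖f t‖ ≤ ‖f‖}.indicator f
  have hfm : StronglyMeasurable f := Lp.stronglyMeasurable f
  have hf₁m : StronglyMeasurable f₁ :=
    hfm.indicator (measurableSet_le hfm.norm.measurable measurable_const)
  have hf₁ : f =ᵐ[haar d] f₁ := by
    filter_upwards [ae_norm_le f] with t ht
    exact (Set.indicator_of_mem (s := {t | ‖f t‖ ≤ ‖f‖}) ht _).symm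
  have hb : ∀ t, ‖f₁ t‖ ≤ ‖f‖ := fun t => by
    simp only [f₁, Set.indicator_apply]
    split_ifs with ht
    · exact ht
    · simp
  have hjoint : ∀ m, Integrable (fun p : UnitAddTorus (Fin d) × UnitAddTorus (Fin d) =>
      mFourier (-m) p.1 * (f₁ (p.1 - p.2) * h p.2)) ((haar d).prod ν) := by
    intro m
    have h2 : Integrable (fun p : UnitAddTorus (Fin d) × UnitAddTorus (Fin d) => h p.2)
        ((haar d).prod ν) := hh.comp_snd (haar d)
    have m1 : StronglyMeasurable fun p : UnitAddTorus (Fin d) × UnitAddTorus (Fin d) =>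
        f₁ (p.1 - p.2) := hf₁m.comp_measurable (measurable_fst.sub measurable_snd)
    have m2 : StronglyMeasurable fun p : UnitAddTorus (Fin d) × UnitAddTorus (Fin d) =>
        mFourier (-m) p.1 := (mFourier (-m)).continuous.stronglyMeasurable.comp_measurable
          measurable_fst
    have h3 : Integrable (fun p : UnitAddTorus (Fin d) × UnitAddTorus (Fin d) =>
        f₁ (p.1 - p.2) * h p.2) ((haar d).prod ν) :=
      h2.bdd_mul m1.aestronglyMeasurable (ae_of_all _ fun p => hb _)
    exact h3.bdd_mul m2.aestronglyMeasurable
      (ae_of_all _ fun p => (mFourier (-m)).norm_coe_le_norm _)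
  set g₁ : UnitAddTorus (Fin d) → ℂ := fun t => ∫ s, f₁ (t - s) * h s ∂ν
  have hg₁m : AEStronglyMeasurable g₁ (haar d) := by
    have := (hjoint 0).aestronglyMeasurable.integral_prod_right'
    simpa [mFourier_zero] using this
  have hg₁b : ∀ t, ‖g₁ t‖ ≤ (∫ s, ‖h s‖ ∂ν) * ‖f‖ := fun t => by
    rw [← integral_mul_const]
    refine norm_integral_le_of_norm_le (hh.norm.mul_const _) (ae_of_all _ fun s => ?_)
    rw [norm_mul, mul_comm]
    gcongr
    exact hb _
  have hg₁ : MemLp g₁ ∞ (haar d) := memLp_top_of_bound hg₁m _ (ae_of_all _ hg₁b)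
  refine ⟨hg₁.toLp g₁, fun m => ?_, norm_le_of_ae_le (by positivity) ?_⟩
  · rw [coeff_congr hg₁.coeFn_toLp, coeff_congr hf₁, fourierTransform_withDensityᵥ hh, coeff]
    simp only [g₁, ← integral_const_mul]
    rw [integral_integral_swap (hjoint m), ← integral_mul_const]
    refine integral_congr_ae (ae_of_all _ fun s => ?_)
    have e1 : ∀ t, mFourier (-m) t * (f₁ (t - s) * h s) =
        (mFourier (-m) s * h s) * (mFourier (-m) (t - s) * f₁ (t - s)) := by
      intro t
      have : mFourier (-m) t = mFourier (-m) s * mFourier (-m) (t - s) := by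
        rw [← mFourier_apply_add, add_sub_cancel]
      rw [this]
      ring
    simp only [e1]
    rw [integral_const_mul, coeff]
    congr 1
    -- Translation invariance of Haar measure.
    exact integral_sub_right_eq_self (fun t => mFourier (-m) t * f₁ t) s
  · filter_upwards [hg₁.coeFn_toLp] with t ht
    rw [ht]
    exact hg₁b t

/-- Convolution with a measure, as an operator on `L_∞(𝕋^d)`. -/
theorem exists_isMultiplierMap [IsFiniteMeasure ν] (hh : Integrable h ν) :
    ∃ T : Linf d →L[ℂ] Linf d,
      IsMultiplierMap (fourierTransform (ν.withDensityᵥ h)) (T : Linf d →ₗ[ℂ] Linf d) ∧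
      ‖T‖ ≤ ∫ s, ‖h s‖ ∂ν := by
  choose T hT hTn using exists_convolution (d := d) hh
  refine ⟨LinearMap.mkContinuous
    { toFun := T
      map_add' := fun f g => linf_ext fun m => by rw [hT, coeff_add, coeff_add, hT, hT, mul_add]
      map_smul' := fun c f => linf_ext fun m => by
        rw [hT, RingHom.id_apply, coeff_smul, coeff_smul, hT, mul_left_comm] }
    (∫ s, ‖h s‖ ∂ν) hTn, hT, LinearMap.mkContinuous_norm_le _ (by positivity) _⟩

/-- The multiplication operator of a bounded function, conjugated by the Fourier transform. -/
def fourierConj (A : L2 d →L[ℂ] L2 d) : QuantumTorus.L2 d →L[ℂ] QuantumTorus.L2 d :=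
  ((fourierIso d).toContinuousLinearEquiv : L2 d →L[ℂ] QuantumTorus.L2 d) ∘L A ∘L
    ((fourierIso d).symm.toContinuousLinearEquiv : QuantumTorus.L2 d →L[ℂ] L2 d)

theorem fourierConj_apply (A : L2 d →L[ℂ] L2 d) (v : QuantumTorus.L2 d) :
    fourierConj A v = fourierIso d (A ((fourierIso d).symm v)) := rfl

/-- Multiplication by `f` becomes a Laurent matrix, constant along diagonals, and this is the shape
on which averaging acts as a Fourier multiplier. -/
theorem fourierConj_mulRep_single (f : Linf d) (j k : Fin d → ℤ) :
    fourierConj (mulRep d f) (lp.single 2 k 1) j = coeff f (j - k) := by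
  have h0 : (fourierIso d).symm (lp.single 2 k 1) = mFourierLp 2 k := by
    rw [← coe_mFourierBasis]
    exact (mFourierBasis (d := Fin d)).repr_symm_single k
  rw [fourierConj_apply, fourierIso_apply, h0, ← coeff_mFourier_mul]
  refine coeff_congr ?_ j
  filter_upwards [coeFn_mulRep f (mFourierLp 2 k), coeFn_mFourierLp (d := Fin d) 2 k] with t h1 h2
  rw [h1, h2, mul_comm]

/-- In Fourier coordinates the matrix of `T f` is the average of the matrix of `f`, entry by entry,
so the bound for averages of unitary conjugations transfers through the Fourier transform. -/
theorem cbNorm_le_of_isMultiplierMap (hh : Integrable h ν) {T : Linf d →ₗ[ℂ] Linf d}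
    (hT : IsMultiplierMap (fourierTransform (ν.withDensityᵥ h)) T) :
    cbNorm (mulRep d) (mulRep d) T ≤ ENNReal.ofReal (∫ z, ‖h z‖ ∂ν) := by
  have key : ∀ f, fourierConj (mulRep d (T f)) =
      QuantumTorus.average hh (fourierConj (mulRep d f)) := fun f => by
    refine QuantumTorus.ext_of_single fun k => ?_
    ext j
    rw [QuantumTorus.average_single_apply, fourierConj_mulRep_single, fourierConj_mulRep_single, hT]
  let W : UnitAddTorus (Fin d) → L2 d ≃ₗᵢ[ℂ] L2 d := fun z =>
    (fourierIso d).trans ((QuantumTorus.modulation z).trans (fourierIso d).symm)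
  have hW : ∀ f ξ η z, inner ℂ (W z η) (mulRep d f (W z ξ)) =
      inner ℂ (QuantumTorus.modulation z (fourierIso d η))
        (fourierConj (mulRep d f) (QuantumTorus.modulation z (fourierIso d ξ))) := by
    intro f ξ η z
    rw [← (fourierIso d).inner_map_map, fourierConj_apply]
    simp [W]
  refine cbNorm_le_of_inner_eq_integral hh W (mulRep d) T (fun f ξ η => ?_) fun f ξ η => ?_
  · simp only [hW]
    exact QuantumTorus.integrable_inner_orbit hh _ _ _
  · simp only [hW]
    rw [← QuantumTorus.inner_average hh, ← key, ← (fourierIso d).inner_map_map, fourierConj_apply,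
      LinearIsometryEquiv.symm_apply_apply]

theorem exists_multiplier_of_measure (μ : ComplexMeasure (UnitAddTorus (Fin d))) :
    ∃ T : Linf d →L[ℂ] Linf d, IsMultiplierMap (fourierTransform μ) (T : Linf d →ₗ[ℂ] Linf d) ∧
      ‖T‖ₑ ≤ μ.variation Set.univ ∧
      cbNorm (mulRep d) (mulRep d) (T : Linf d →ₗ[ℂ] Linf d) ≤ μ.variation Set.univ := by
  obtain ⟨ν, h, hν, hh, rfl⟩ := μ.exists_eq_withDensityᵥ
  obtain ⟨T, hT, hTn⟩ := exists_isMultiplierMap hh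
  rw [Measure.variation_withDensityᵥ hh, withDensity_apply _ MeasurableSet.univ,
    Measure.restrict_univ, ← ofReal_integral_norm_eq_lintegral_enorm hh]
  refine ⟨T, hT, ?_, cbNorm_le_of_isMultiplierMap hh hT⟩
  rw [← ofReal_norm]
  exact ENNReal.ofReal_le_ofReal hTn

end ClassicalTorus

end ClassicalMultipliers

theorem MeasureTheory.ComplexMeasure.variation_univ_lt_top {X : Type*} [MeasurableSpace X]
    (μ : ComplexMeasure X) : μ.variation Set.univ < ∞ := by
  obtain ⟨ν, h, hν, hh, rfl⟩ := μ.exists_eq_withDensityᵥ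
  have := isFiniteMeasure_variation_withDensityᵥ hh
  exact measure_lt_top _ _

/-! ### The common conclusion for the three families of multipliers -/

section MultiplierFamily

variable {d : ℕ} {ι : Type*} {P : ((Fin d → ℤ) → ℂ) → ι → Prop} {N : ι → ℝ≥0∞}

/-- If the elements of finite size `N` with symbol `φ` bound `φ` as a functional on trigonometric
polynomials, the symbols that occur are Fourier transforms of measures. -/
theorem mem_range_fourierTransform
    (hP : ∀ φ T, P φ T → N T ≠ ∞ → SymbolBound φ (N T).toReal) {φ : (Fin d → ℤ) → ℂ} {T : ι}
    (hT : P φ T) (hN : N T ≠ ∞) : φ ∈ Set.range (ClassicalTorus.fourierTransform (d := d)) :=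
  (hP φ T hT hN).exists_fourierTransform_eq

theorem setOf_exists_eq_range_fourierTransform
    (hP : ∀ φ T, P φ T → N T ≠ ∞ → SymbolBound φ (N T).toReal)
    (hex : ∀ μ, ∃ T, P (ClassicalTorus.fourierTransform μ) T ∧ N T ≤ μ.variation Set.univ) :
    {φ | ∃ T, P φ T ∧ N T < ∞} = Set.range (ClassicalTorus.fourierTransform (d := d)) := by
  ext φ
  constructor
  · rintro ⟨T, hT, hN⟩
    exact mem_range_fourierTransform hP hT hN.ne
  · rintro ⟨μ, rfl⟩
    obtain ⟨T, hT, hN⟩ := hex μ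
    exact ⟨T, hT, hN.trans_lt μ.variation_univ_lt_top⟩

theorem iInf_fourierTransform_eq_variation
    (hP : ∀ φ T, P φ T → N T ≠ ∞ → SymbolBound φ (N T).toReal)
    (hex : ∀ μ, ∃ T, P (ClassicalTorus.fourierTransform μ) T ∧ N T ≤ μ.variation Set.univ)
    (μ : ComplexMeasure (UnitAddTorus (Fin d))) :
    ⨅ (T : ι) (_ : P (ClassicalTorus.fourierTransform μ) T), N T = μ.variation Set.univ := by
  apply le_antisymm
  · obtain ⟨T, hT, hN⟩ := hex μ
    exact (iInf₂_le T hT).trans hN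
  · refine le_iInf₂ fun T hT => ?_
    by_cases hN : N T = ∞
    · simp [hN]
    · simpa [ENNReal.ofReal_toReal hN] using (hP _ T hT hN).variation_le

/-- Off the range no admissible map has finite size. The norms thus agree in `[0, ∞]` for every
symbol, including those that are not multipliers. -/
theorem iInf_eq_top_of_notMem_range
    (hP : ∀ φ T, P φ T → N T ≠ ∞ → SymbolBound φ (N T).toReal) {φ : (Fin d → ℤ) → ℂ}
    (hφ : φ ∉ Set.range (ClassicalTorus.fourierTransform (d := d))) :
    ⨅ (T : ι) (_ : P φ T), N T = ∞ := by
  rw [iInf₂_eq_top]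
  intro T hT
  by_contra hN
  exact hφ (mem_range_fourierTransform hP hT hN)

end MultiplierFamily

theorem mainTheorem9 {d : ℕ} (hd : 2 ≤ d) (θ : Matrix (Fin d) (Fin d) ℝ) (hθ : θᵀ = -θ) :
    QuantumTorus.cbMultipliers θ = ClassicalTorus.cbMultipliers d ∧
    ClassicalTorus.cbMultipliers d = ClassicalTorus.multipliers d ∧
    ClassicalTorus.multipliers d = Set.range ClassicalTorus.fourierTransform ∧
    (∀ φ : (Fin d → ℤ) → ℂ,
      QuantumTorus.cbMultiplierNorm θ φ = ClassicalTorus.cbMultiplierNorm φ ∧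
      ClassicalTorus.cbMultiplierNorm φ = ClassicalTorus.multiplierNorm φ) ∧
    (∀ μ : ComplexMeasure (UnitAddTorus (Fin d)),
      ClassicalTorus.multiplierNorm (ClassicalTorus.fourierTransform μ) =
        μ.variation Set.univ) := by
  have hq := fun φ T (h : QuantumTorus.IsMultiplierMap θ φ T)
    (hN : cbNorm (QuantumTorus.incl θ) (QuantumTorus.incl θ) T ≠ ∞) =>
      QuantumTorus.symbolBound_of_isMultiplierMap θ h hN
  have hc := fun (φ : (Fin d → ℤ) → ℂ) T (h : ClassicalTorus.IsMultiplierMap φ T)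
    (hN : cbNorm (ClassicalTorus.mulRep d) (ClassicalTorus.mulRep d) T ≠ ∞) =>
      ClassicalTorus.symbolBound_of_cbNorm h hN
  have hb : ∀ (φ : (Fin d → ℤ) → ℂ) (T : ClassicalTorus.Linf d →L[ℂ] ClassicalTorus.Linf d),
      ClassicalTorus.IsMultiplierMap φ (T : ClassicalTorus.Linf d →ₗ[ℂ] ClassicalTorus.Linf d) →
        ‖T‖ₑ ≠ ∞ → SymbolBound φ (‖T‖ₑ).toReal := fun φ T h _ => by
    rw [toReal_enorm]
    exact ClassicalTorus.symbolBound_of_isMultiplierMap h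
  have eq := QuantumTorus.exists_multiplier_of_measure θ
  have ec : ∀ μ : ComplexMeasure (UnitAddTorus (Fin d)),
      ∃ T, ClassicalTorus.IsMultiplierMap (ClassicalTorus.fourierTransform μ) T ∧
        cbNorm (ClassicalTorus.mulRep d) (ClassicalTorus.mulRep d) T ≤ μ.variation Set.univ :=
    fun μ => by
      obtain ⟨T, hT, -, hN⟩ := ClassicalTorus.exists_multiplier_of_measure μ
      exact ⟨T, hT, hN⟩
  have eb : ∀ μ : ComplexMeasure (UnitAddTorus (Fin d)),
      ∃ T : ClassicalTorus.Linf d →L[ℂ] ClassicalTorus.Linf d,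
        ClassicalTorus.IsMultiplierMap (ClassicalTorus.fourierTransform μ)
          (T : ClassicalTorus.Linf d →ₗ[ℂ] ClassicalTorus.Linf d) ∧
        ‖T‖ₑ ≤ μ.variation Set.univ := fun μ => by
    obtain ⟨T, hT, hN, -⟩ := ClassicalTorus.exists_multiplier_of_measure μ
    exact ⟨T, hT, hN⟩
  have rq : QuantumTorus.cbMultipliers θ = _ := setOf_exists_eq_range_fourierTransform hq eq
  have rc : ClassicalTorus.cbMultipliers d = _ := setOf_exists_eq_range_fourierTransform hc ec
  have rb : ClassicalTorus.multipliers d = Set.range ClassicalTorus.fourierTransform := by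
    -- For continuous operators the finiteness condition on the norm holds automatically.
    rw [← setOf_exists_eq_range_fourierTransform hb eb]
    simp [ClassicalTorus.multipliers]
  refine ⟨rq.trans rc.symm, rc.trans rb.symm, rb, fun φ => ?_,
    iInf_fourierTransform_eq_variation hb eb⟩
  by_cases hφ : φ ∈ Set.range (ClassicalTorus.fourierTransform (d := d))
  · obtain ⟨μ, rfl⟩ := hφ
    exact ⟨(iInf_fourierTransform_eq_variation hq eq μ).trans
        (iInf_fourierTransform_eq_variation hc ec μ).symm,
      (iInf_fourierTransform_eq_variation hc ec μ).trans
        (iInf_fourierTransform_eq_variation hb eb μ).symm⟩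
  · exact ⟨(iInf_eq_top_of_notMem_range hq hφ).trans (iInf_eq_top_of_notMem_range hc hφ).symm,
      (iInf_eq_top_of_notMem_range hc hφ).trans (iInf_eq_top_of_notMem_range hb hφ).symm⟩
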